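/- Let $n\ge 1$, let $\mathbb B=\{z\in\mathbb C^n:|z|<1\}$ with $\langle z,w\rangle=\sum_{i}z_i\overline{w_i}$, let $dV$ be volume measure on $\mathbb B$ normalized so that $V(\mathbb B)=1$, and let $d\lambda(z)=(1-|z|^2)^{-n-1}dV(z)$. For $a\in\mathbb B$ let $$\Phi_a(z)=\frac{a-P_az-\sqrt{1-|a|^2}\,(z-P_az)}{1-\langle z,a\rangle},$$ where $P_a$ is the orthogonal projection onto $\mathbb Ca$ (so $P_0=0$ and $\Phi_0(z)=-z$). For $p\ge1$, $q>0$, $s>0$, the space $\mathcal N(p,q,s)$ consists of the holomorphic functions $f$ on $\mathbb B$ with $$\sup_{a\in\mathbb B}\int_{\mathbb B}|f(z)|^p(1-|z|^2)^q(1-|\Phi_a(z)|^2)^{ns}\,d\lambda(z)<\infty .$$ For $f$ holomorphic on $\mathbb B$ and $z\in\mathbb B$, define the $p$-mean oscillation (with values in $[0,\infty]$) $$MO_p(f)(z)=\Big(\int_{\mathbb B}|f(z)-f(w)|^p\frac{(1-|z|^2)^{n+1}}{|1-\langle z,w\rangle|^{2(n+1)}}\,dV(w)\Big)^{1/p}$$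 and $$J(f)=\sup_{a\in\mathbb B}\int_{\mathbb B}MO_p(f)(z)^p(1-|z|^2)^q(1-|\Phi_a(z)|^2)^{ns}\,d\lambda(z).$$ **Theorem 3.3.** Let $f$ be holomorphic on $\mathbb B$, $p\ge1$, $q>0$ and $s>\max\{0,1-q/n\}$. If $J(f)<\infty$, then $f\in\mathcal N(p,q,s)$. If moreover $q+ns<n+1$, then $f\in\mathcal N(p,q,s)$ if and only if $J(f)<\infty$. -/

import Mathlib

open MeasureTheory
open scoped ENNReal

/-- The complex space `ℂⁿ` with its Euclidean norm. -/
abbrev Cn (n : ℕ) : Type := EuclideanSpace ℂ (Fin n)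

/-- The open unit ball of `ℂⁿ`. -/
abbrev unitBall (n : ℕ) : Set (Cn n) := Metric.ball 0 1

/-- The pairing `⟨z, w⟩ = ∑ᵢ zᵢ conj(wᵢ)`, linear in the first variable (Mathlib's `inner`
is linear in the second one). -/
noncomputable def pairing {n : ℕ} (z w : Cn n) : ℂ := inner ℂ w z

/-- The involutive automorphism `Φ_a` of the unit ball:
`Φ_a(z) = (a - P_a z - s_a Q_a z) / (1 - ⟨z, a⟩)`, where `P_a` is the orthogonal projection onto
the span of `a`, `Q_a = I - P_a` and `s_a = √(1 - |a|²)`. For `a = 0` one has `P_a = 0`, which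
gives the usual convention `Φ_0(z) = -z`. -/
noncomputable def Phi {n : ℕ} (a z : Cn n) : Cn n :=
  (1 - pairing z a)⁻¹ •
    (a - (Submodule.span ℂ {a}).starProjection z
      - (Real.sqrt (1 - ‖a‖ ^ 2) : ℂ) • (z - (Submodule.span ℂ {a}).starProjection z))

/-- The volume measure on the unit ball, normalized to have total mass one. -/
noncomputable def ballVolume (n : ℕ) : Measure (Cn n) :=
  (volume (unitBall n))⁻¹ • volume.restrict (unitBall n)

/-- The Möbius invariant measure `dλ(z) = (1 - |z|²)^(-n-1) dV(z)` on the unit ball. -/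
noncomputable def invMeasure (n : ℕ) : Measure (Cn n) :=
  (ballVolume n).withDensity fun z => ENNReal.ofReal ((1 - ‖z‖ ^ 2) ^ (-(n : ℝ) - 1))

/-- The weight `(1 - |z|²)^q (1 - |Φ_a(z)|²)^(ns)`. -/
noncomputable def weight {n : ℕ} (q s : ℝ) (a z : Cn n) : ℝ≥0∞ :=
  ENNReal.ofReal ((1 - ‖z‖ ^ 2) ^ q * (1 - ‖Phi a z‖ ^ 2) ^ ((n : ℝ) * s))

/-- The space `𝒩(p,q,s)`: functions holomorphic on the unit ball with
`sup_a ∫ |f(z)|^p (1 - |z|²)^q (1 - |Φ_a(z)|²)^(ns) dλ(z) < ∞`. -/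
def NSpace (n : ℕ) (p q s : ℝ) : Set (Cn n → ℂ) :=
  {f | DifferentiableOn ℂ f (unitBall n) ∧
    (⨆ a ∈ unitBall n, ∫⁻ z, ‖f z‖ₑ ^ p * weight q s a z ∂(invMeasure n)) < ⊤}

/-- The `p`-mean oscillation of `f` at `z`, with values in `[0, ∞]`:
`(∫ |f(z) - f(w)|^p (1 - |z|²)^(n+1) / |1 - ⟨z, w⟩|^(2(n+1)) dV(w))^(1/p)`. -/
noncomputable def meanOsc {n : ℕ} (p : ℝ) (f : Cn n → ℂ) (z : Cn n) : ℝ≥0∞ :=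
  (∫⁻ w, ‖f z - f w‖ₑ ^ p *
      ENNReal.ofReal ((1 - ‖z‖ ^ 2) ^ (n + 1) / ‖1 - pairing z w‖ ^ (2 * (n + 1)))
    ∂(ballVolume n)) ^ (1 / p)

/-- `J(f) = sup_a ∫ MO_p(f)(z)^p (1 - |z|²)^q (1 - |Φ_a(z)|²)^(ns) dλ(z)`. -/
noncomputable def oscFunctional {n : ℕ} (p q s : ℝ) (f : Cn n → ℂ) : ℝ≥0∞ :=
  ⨆ a ∈ unitBall n, ∫⁻ z, meanOsc p f z ^ p * weight q s a z ∂(invMeasure n)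

/-! ### The quasi-metric `|1 - ⟨z, w⟩|` and the automorphisms `Φ_a`. -/

section Geometry

variable {n : ℕ}

/-! Put `t = q + n s - n - 1` and `c = n s`. The identity `one_sub_norm_Phi_sq` turns both suprema
into bounds, uniform in `a`, for `moebiusIntegral t c`, whose weight is `(1-|a|²)^c (1-|z|²)^t
|1-⟨z,a⟩|^(-2c)`. The condition on `s` says `c > 0` and `t > -1`, and `t + n + 1 - c = q`.

Suppose `J(f) < ∞`. Sub-mean values on nonisotropic neighbourhoods show that the oscillation at `z`
controls `|f(z) - f(w)|` for nearby `w`, hence, by Cauchy's estimate on the complex line through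
`z`, the radial derivative (`enorm_deriv_radial_rpow_le`). Testing the supremum at `a = z` and
integrating along the radius gives the growth `|f(z)|^p ≲ (1-|z|)^(-q)` (`enorm_rpow_le_growth`).
Now fix `a` and compare `f(z)` with `f(τ₀ z)`, where `1 - τ₀ = |1-⟨z,a⟩|/4`. The growth bound makes
`|f(τ₀ z)|^p ≲ |1-⟨z,a⟩|^(-q)`, which has bounded integral by Forelli–Rudin
(`moebiusIntegral_koranyi_le`). The difference is a radial integral of oscillations over a segment
on which `|1-⟨·,a⟩|` is essentially constant, so a weighted Hölder inequality
(`enorm_sub_radial_rpow_le`) and a Hardy-type inequality (`moebiusIntegral_radial_le`) bound it by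
`J(f)`.

Conversely, `|f(z) - f(w)|^p ≲ |f(z)|^p + |f(w)|^p`. The Berezin kernel has bounded mass, which
handles the first term. The second requires the kernel's transpose to preserve the weight up to a
constant; this is the two-point estimate `lintegral_koranyi_mul_koranyi_le`, available exactly when
`t < 0`, that is `q + n s < n + 1`.

All kernel integrals come from one volume bound: `(1-|z|²)^t dz` gives `{|1-⟨z,a⟩| < D}` mass at
most a constant times `D^(n+1+t)` (`powMeasure_koranyi_le`). -/

theorem pairing_sub_left (z w a : Cn n) : pairing (z - w) a = pairing z a - pairing w a :=
  inner_sub_right _ _ _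

theorem pairing_add_left (z w a : Cn n) : pairing (z + w) a = pairing z a + pairing w a :=
  inner_add_right _ _ _

theorem pairing_smul_left (c : ℂ) (z a : Cn n) : pairing (c • z) a = c * pairing z a :=
  inner_smul_right _ _ _

theorem pairing_smul_right (c : ℂ) (z a : Cn n) :
    pairing z (c • a) = (starRingEnd ℂ) c * pairing z a :=
  inner_smul_left _ _ _

theorem pairing_symm (z w : Cn n) : (starRingEnd ℂ) (pairing z w) = pairing w z :=
  inner_conj_symm _ _

theorem norm_pairing_le (z w : Cn n) : ‖pairing z w‖ ≤ ‖z‖ * ‖w‖ := by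
  rw [mul_comm]; exact norm_inner_le_norm w z

theorem pairing_self (z : Cn n) : pairing z z = ((‖z‖ ^ 2 : ℝ) : ℂ) := by
  rw [pairing, inner_self_eq_norm_sq_to_K]; norm_cast

theorem continuous_pairing : Continuous fun x : Cn n × Cn n => pairing x.1 x.2 := by
  unfold pairing; fun_prop

/-- The quantity `|1 - ⟨z, w⟩|`, comparable to the square of the nonisotropic distance. -/
noncomputable def koranyi (z w : Cn n) : ℝ := ‖1 - pairing z w‖

theorem continuous_koranyi : Continuous fun x : Cn n × Cn n => koranyi x.1 x.2 := by
  have := continuous_pairing (n := n)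
  unfold koranyi
  fun_prop

theorem continuous_koranyi_left (a : Cn n) : Continuous fun z : Cn n => koranyi z a :=
  continuous_koranyi.comp (f := fun z : Cn n => (z, a)) (by fun_prop)

theorem koranyi_comm (z w : Cn n) : koranyi z w = koranyi w z := by
  unfold koranyi
  rw [← pairing_symm w z, ← RCLike.norm_conj (1 - pairing w z)]
  simp

theorem koranyi_nonneg (z w : Cn n) : 0 ≤ koranyi z w := norm_nonneg _

theorem one_sub_mul_le_koranyi (z w : Cn n) : 1 - ‖z‖ * ‖w‖ ≤ koranyi z w := by
  have h := norm_sub_norm_le (1 : ℂ) (pairing z w)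
  rw [norm_one] at h
  have := norm_pairing_le z w
  unfold koranyi
  linarith

theorem one_sub_norm_left_le_koranyi {z w : Cn n} (hw : ‖w‖ ≤ 1) :
    1 - ‖z‖ ≤ koranyi z w := by
  have := one_sub_mul_le_koranyi z w
  nlinarith [norm_nonneg z]

theorem one_sub_norm_right_le_koranyi {z w : Cn n} (hz : ‖z‖ ≤ 1) :
    1 - ‖w‖ ≤ koranyi z w := by
  rw [koranyi_comm]; exact one_sub_norm_left_le_koranyi hz

theorem koranyi_pos {z w : Cn n} (hz : ‖z‖ < 1) (hw : ‖w‖ ≤ 1) : 0 < koranyi z w :=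
  lt_of_lt_of_le (by linarith) (one_sub_norm_left_le_koranyi hw)

theorem koranyi_lt_two {z w : Cn n} (hz : ‖z‖ < 1) (hw : ‖w‖ ≤ 1) : koranyi z w < 2 := by
  have h := norm_sub_le (1 : ℂ) (pairing z w)
  rw [norm_one] at h
  have := norm_pairing_le z w
  unfold koranyi
  nlinarith [norm_nonneg z, norm_nonneg w]

theorem koranyi_le_add (z w a : Cn n) : koranyi z a ≤ koranyi w a + ‖z - w‖ * ‖a‖ := by
  have h := norm_sub_le (1 - pairing w a) (pairing (z - w) a)
  have := norm_pairing_le (z - w) a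
  rw [show 1 - pairing w a - pairing (z - w) a = 1 - pairing z a by
    rw [pairing_sub_left]; ring] at h
  unfold koranyi
  linarith

theorem exists_unit_direction (hn : 1 ≤ n) (w : Cn n) :
    ∃ e : Cn n, ‖e‖ = 1 ∧ w = (‖w‖ : ℂ) • e := by
  by_cases hw : w = 0
  · refine ⟨EuclideanSpace.single ⟨0, hn⟩ 1, by simp, by simp [hw]⟩
  · have : ‖w‖ ≠ 0 := by simpa using hw
    refine ⟨((‖w‖ : ℂ)⁻¹) • w, ?_, ?_⟩
    · rw [norm_smul]; simp [this]
    · rw [smul_smul, mul_inv_cancel₀ (by exact_mod_cast this), one_smul]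

theorem norm_sub_pairing_smul_sq {e : Cn n} (he : ‖e‖ = 1) (z : Cn n) :
    ‖z - pairing z e • e‖ ^ 2 = ‖z‖ ^ 2 - ‖pairing z e‖ ^ 2 := by
  have h := norm_sub_sq (𝕜 := ℂ) z (pairing z e • e)
  rw [inner_smul_right, norm_smul, he, mul_one] at h
  have h2 : inner ℂ z e = (starRingEnd ℂ) (pairing z e) := (inner_conj_symm _ _).symm
  rw [h2, Complex.mul_conj, Complex.normSq_eq_norm_sq] at h
  rw [h]; simp [-Complex.ofReal_pow]; ring

theorem pairing_eq_of_unit {e : Cn n} (he : ‖e‖ = 1) (z w : Cn n) :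
    pairing z w = pairing z e * (starRingEnd ℂ) (pairing w e)
      + pairing (z - pairing z e • e) (w - pairing w e • e) := by
  have h1 : inner ℂ e e = (1 : ℂ) := by rw [inner_self_eq_norm_sq_to_K, he]; simp
  unfold pairing
  simp only [inner_sub_left, inner_sub_right, inner_smul_left, inner_smul_right, h1,
    inner_conj_symm]
  ring

theorem one_sub_sq_le_two_mul {α : ℂ} : 1 - ‖α‖ ^ 2 ≤ 2 * ‖1 - α‖ := by
  have h := norm_sub_norm_le (1 : ℂ) α
  rw [norm_one] at h
  nlinarith [norm_nonneg α, norm_nonneg (1 - α), sq_nonneg (1 - ‖α‖)]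

/-- Split `z` and `w` along `e`, with coordinates `α` and `β`. The parallel parts contribute `|1 - α
β̄| ≤ |1-α| + |1-β|`. The orthogonal parts have squared norms at most `1 - |α|² ≤ 2|1-α|` and `1 -
|β|² ≤ 2|1-β|`, so their pairing costs the same amount again. -/
theorem koranyi_le_of_unit {e z w : Cn n} (he : ‖e‖ = 1) (hz : ‖z‖ < 1) (hw : ‖w‖ < 1) :
    koranyi z w ≤ 2 * (koranyi z e + koranyi w e) := by
  set α := pairing z e with hα
  set β := pairing w e with hβ
  have hαn : ‖α‖ ≤ 1 := by
    have := norm_pairing_le z e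
    rw [he, mul_one] at this; linarith
  have h1 := norm_sub_pairing_smul_sq he z
  have h2 := norm_sub_pairing_smul_sq he w
  have h3 := norm_pairing_le (z - α • e) (w - β • e)
  have h4 := pairing_eq_of_unit he z w
  have h5 := one_sub_sq_le_two_mul (α := α)
  have h6 := one_sub_sq_le_two_mul (α := β)
  have h7 : ‖1 - α * (starRingEnd ℂ) β‖ ≤ ‖1 - α‖ + ‖1 - β‖ := by
    have : 1 - α * (starRingEnd ℂ) β = (1 - α) + α * (starRingEnd ℂ) (1 - β) := by
      simp; ring
    rw [this]
    refine (norm_add_le _ _).trans ?_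
    rw [norm_mul, RCLike.norm_conj]
    nlinarith [norm_nonneg (1 - β)]
  have h8 : koranyi z w ≤ ‖1 - α * (starRingEnd ℂ) β‖
      + ‖pairing (z - α • e) (w - β • e)‖ := by
    unfold koranyi
    rw [h4, ← sub_sub]
    exact norm_sub_le _ _
  change koranyi z w ≤ 2 * (‖1 - α‖ + ‖1 - β‖)
  nlinarith [sq_nonneg (‖z - α • e‖ - ‖w - β • e‖), norm_nonneg z, norm_nonneg w]

/-- Pushing `a` out to the sphere changes the pairing by at most `1 - |a|`, which is itself at most
`|1-⟨z,a⟩|`. This reduces estimates centred at `a` to the boundary case. -/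
theorem koranyi_unit_le {e z a : Cn n} (he : ‖e‖ = 1) (ha : a = (‖a‖ : ℂ) • e)
    (ha1 : ‖a‖ ≤ 1) (hz : ‖z‖ ≤ 1) : koranyi z e ≤ 2 * koranyi z a := by
  have h1 : pairing z a = ‖a‖ * pairing z e := by
    conv_lhs => rw [ha]
    rw [pairing_smul_right]; simp
  have h2 : 1 - pairing z e = (1 - pairing z a) - ((1 - ‖a‖ : ℝ) : ℂ) * pairing z e := by
    rw [h1]; push_cast; ring
  have h3 := norm_sub_le (1 - pairing z a) (((1 - ‖a‖ : ℝ) : ℂ) * pairing z e)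
  rw [← h2, norm_mul, Complex.norm_real, Real.norm_of_nonneg (by linarith)] at h3
  have h4 := norm_pairing_le z e
  rw [he, mul_one] at h4
  have h5 := one_sub_norm_right_le_koranyi (w := a) hz
  unfold koranyi at *
  nlinarith [norm_nonneg (pairing z e)]

theorem koranyi_quasi_triangle (hn : 1 ≤ n) {z w a : Cn n} (hz : ‖z‖ < 1) (hw : ‖w‖ < 1)
    (ha : ‖a‖ ≤ 1) : koranyi z w ≤ 4 * (koranyi z a + koranyi a w) := by
  obtain ⟨e, he, hae⟩ := exists_unit_direction hn a
  have h1 := koranyi_le_of_unit he hz hw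
  have h2 := koranyi_unit_le he hae ha hz.le
  have h3 := koranyi_unit_le he hae ha hw.le
  rw [koranyi_comm a w]
  linarith

/-- Pythagoras for `P_a` and its complement in the numerator; `|⟨a, P_a z⟩| = |a| |P_a z|` because
`P_a z` is a multiple of `a`. -/
theorem one_sub_norm_Phi_sq {a z : Cn n} (ha : ‖a‖ < 1) (hz : ‖z‖ < 1) :
    1 - ‖Phi a z‖ ^ 2 = (1 - ‖a‖ ^ 2) * (1 - ‖z‖ ^ 2) / koranyi z a ^ 2 := by
  have hk : 0 < koranyi z a := koranyi_pos hz ha.le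
  have key : ‖a - (Submodule.span ℂ {a}).starProjection z
      - (Real.sqrt (1 - ‖a‖ ^ 2) : ℂ) • (z - (Submodule.span ℂ {a}).starProjection z)‖ ^ 2
      = koranyi z a ^ 2 - (1 - ‖a‖ ^ 2) * (1 - ‖z‖ ^ 2) := by
    set P := (Submodule.span ℂ {a}).starProjection z with hP
    set s := Real.sqrt (1 - ‖a‖ ^ 2) with hs
    have hs2 : s ^ 2 = 1 - ‖a‖ ^ 2 := Real.sq_sqrt (by nlinarith [norm_nonneg a])
    have hmem : P ∈ Submodule.span ℂ {a} := Submodule.starProjection_apply_mem _ _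
    have horth : ∀ x ∈ Submodule.span ℂ {a}, inner ℂ x (z - P) = 0 := fun x hx =>
      (Submodule.mem_orthogonal _ _).1 (Submodule.sub_starProjection_mem_orthogonal z) x hx
    have ham : a ∈ Submodule.span ℂ {a} := Submodule.mem_span_singleton_self a
    have e1 : ‖a - P - (s : ℂ) • (z - P)‖ ^ 2 = ‖a - P‖ ^ 2 + s ^ 2 * ‖z - P‖ ^ 2 := by
      rw [norm_sub_sq (𝕜 := ℂ), inner_smul_right, horth _ (Submodule.sub_mem _ ham hmem),
        norm_smul, mul_pow]
      simp [-Complex.ofReal_pow]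
    have e2 : ‖z‖ ^ 2 = ‖P‖ ^ 2 + ‖z - P‖ ^ 2 := by
      have := norm_add_sq (𝕜 := ℂ) P (z - P)
      rw [horth _ hmem] at this
      simpa using this
    have e3 : pairing z a = inner ℂ a P := by
      have : inner ℂ a (z - P) = 0 := horth _ ham
      rw [inner_sub_right, sub_eq_zero] at this
      exact this
    have e4 : ‖inner ℂ a P‖ = ‖a‖ * ‖P‖ := by
      obtain ⟨c, hc⟩ := Submodule.mem_span_singleton.1 hmem
      rw [← hc, inner_smul_right, inner_self_eq_norm_sq_to_K, norm_smul, norm_mul]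
      simp; ring
    have e5 : koranyi z a ^ 2 = 1 - 2 * (inner ℂ a P).re + ‖inner ℂ a P‖ ^ 2 := by
      unfold koranyi
      rw [e3, norm_sub_sq (𝕜 := ℂ)]
      simp
    have e6 := norm_sub_sq (𝕜 := ℂ) a P
    rw [e1, hs2, e6, e5, e4]
    simp only [RCLike.re_to_complex]
    rw [e2]; ring
  have hinv : ‖(1 - pairing z a)⁻¹‖ = (koranyi z a)⁻¹ := norm_inv _
  rw [Phi, norm_smul, mul_pow, key, hinv]
  field_simp
  ring

end Geometry

/-! ### Anisotropic dilations and the volume of nonisotropic balls. -/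

section Anisotropic

variable {n : ℕ}

/-- The linear map multiplying the direction of the unit vector `e` by `r²` and its orthogonal
complement by `r`. -/
noncomputable def anisoScale (e : Cn n) (r : ℝ) : Cn n →ₗ[ℂ] Cn n :=
  (r : ℂ) • LinearMap.transvection (-((1 - r : ℝ) : ℂ) • (innerSL ℂ e).toLinearMap) e

theorem anisoScale_apply (e : Cn n) (r : ℝ) (u : Cn n) :
    anisoScale e r u = (r : ℂ) • (u - (((1 - r : ℝ) : ℂ) * pairing u e) • e) := by
  simp only [anisoScale, LinearMap.smul_apply, LinearMap.transvection.apply, pairing,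
    ContinuousLinearMap.coe_coe, innerSL_apply_apply, smul_eq_mul]
  push_cast
  module

/-- The scalar `r` contributes `r^n` and the transvection one more factor `r`. The real determinant
is the squared modulus, which produces the exponent `n + 1` in `D = r²`. -/
theorem det_anisoScale {e : Cn n} (he : ‖e‖ = 1) (r : ℝ) :
    LinearMap.det (anisoScale e r) = (r : ℂ) ^ (n + 1) := by
  have h1 : inner ℂ e e = (1 : ℂ) := by rw [inner_self_eq_norm_sq_to_K, he]; simp
  rw [anisoScale, LinearMap.det_smul, LinearMap.transvection.det]
  simp [he, pow_succ]

theorem det_real_anisoScale {e : Cn n} (he : ‖e‖ = 1) (r : ℝ) :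
    LinearMap.det ((anisoScale e r).restrictScalars ℝ) = (r ^ 2) ^ (n + 1) := by
  rw [LinearMap.det_restrictScalars, det_anisoScale he, Algebra.norm_complex_apply, map_pow,
    Complex.normSq_ofReal]
  ring

theorem continuous_anisoScale (e : Cn n) (r : ℝ) : Continuous (anisoScale e r) :=
  LinearMap.continuous_of_finiteDimensional _

theorem lintegral_comp_anisoScale {e : Cn n} (he : ‖e‖ = 1) {r : ℝ} (hr : 0 < r)
    {F : Cn n → ℝ≥0∞} (hF : Measurable F) :
    ∫⁻ u, F (anisoScale e r u) = ENNReal.ofReal ((r ^ 2) ^ (n + 1))⁻¹ * ∫⁻ u, F u := by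
  have hd := det_real_anisoScale he r
  have hpos : 0 < (r ^ 2) ^ (n + 1) := by positivity
  have := Measure.map_linearMap_addHaar_eq_smul_addHaar (volume : Measure (Cn n))
    (f := (anisoScale e r).restrictScalars ℝ) (by rw [hd]; exact hpos.ne')
  rw [hd, abs_of_pos (inv_pos.2 hpos)] at this
  have h2 := lintegral_map (μ := volume) hF (continuous_anisoScale e r).measurable
  rw [← h2]
  change ∫⁻ a, F a ∂(Measure.map ((anisoScale e r).restrictScalars ℝ) volume) = _
  rw [this, lintegral_smul_measure, smul_eq_mul]

theorem volume_image_anisoScale {e : Cn n} (he : ‖e‖ = 1) (r : ℝ) (s : Set (Cn n)) :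
    volume (anisoScale e r '' s) = ENNReal.ofReal ((r ^ 2) ^ (n + 1)) * volume s := by
  have := Measure.addHaar_image_linearMap (volume : Measure (Cn n))
    ((anisoScale e r).restrictScalars ℝ) s
  rw [det_real_anisoScale he, abs_of_nonneg (by positivity)] at this
  exact this

theorem volume_koranyi_unit_le {e : Cn n} (he : ‖e‖ = 1) {D : ℝ} (hD : 0 < D) :
    volume {z ∈ unitBall n | koranyi z e < D}
      ≤ ENNReal.ofReal (D ^ (n + 1)) * volume (Metric.ball (0 : Cn n) 2) := by
  set r := Real.sqrt D with hr
  have hr0 : 0 < r := Real.sqrt_pos.2 hD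
  have hr2 : r ^ 2 = D := Real.sq_sqrt hD.le
  -- After undoing the dilation with `r² = D`, the component of `z - e` along `e` has norm below `1`
  -- and the orthogonal one has squared norm at most `2`; since `1 + 2 < 2²`, radius `2` suffices.
  have hsub : {z ∈ unitBall n | koranyi z e < D} ⊆
      (fun x => e + x) '' (anisoScale e r '' Metric.ball 0 2) := by
    rintro z ⟨hz, hzD⟩
    have hz1 : ‖z‖ < 1 := by simpa using hz
    set α := pairing z e with hα
    have h11 : pairing e e = 1 := by rw [pairing_self, he]; simp
    have hw : pairing (z - α • e) e = 0 := by
      rw [pairing_sub_left, pairing_smul_left, h11]; simp [hα]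
    have hrc : (r : ℂ) ≠ 0 := by exact_mod_cast hr0.ne'
    refine ⟨z - e, ⟨((α - 1) / (r : ℂ) ^ 2) • e + (r : ℂ)⁻¹ • (z - α • e), ?_, ?_⟩, by simp⟩
    · rw [mem_ball_zero_iff]
      have horth : inner ℂ (((α - 1) / (r : ℂ) ^ 2) • e) ((r : ℂ)⁻¹ • (z - α • e)) = 0 := by
        rw [inner_smul_left, inner_smul_right]
        have : inner ℂ e (z - α • e) = 0 := hw
        rw [this]; simp
      have hn := norm_add_sq (𝕜 := ℂ) (((α - 1) / (r : ℂ) ^ 2) • e) ((r : ℂ)⁻¹ • (z - α • e))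
      rw [horth, norm_smul, norm_smul, mul_pow, mul_pow, norm_sub_pairing_smul_sq he z, he] at hn
      simp only [norm_div, norm_pow, Complex.norm_real, norm_inv, Real.norm_of_nonneg hr0.le,
        hr2, map_zero, mul_zero, add_zero, one_pow, mul_one] at hn
      have hb : ‖α - 1‖ < D := by rw [norm_sub_rev]; exact hzD
      have hb2 : ‖α - 1‖ / D < 1 := (div_lt_one hD).2 hb
      have h5 := one_sub_sq_le_two_mul (α := α)
      have h6 : ‖z‖ ^ 2 - ‖α‖ ^ 2 ≤ 2 * D := by
        have : ‖1 - α‖ < D := hzD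
        nlinarith [norm_nonneg z]
      have h7 : r⁻¹ ^ 2 * (‖z‖ ^ 2 - ‖α‖ ^ 2) ≤ 2 := by
        rw [inv_pow, hr2, inv_mul_le_iff₀ hD]; linarith
      have h8 : (‖α - 1‖ / D) ^ 2 < 1 := by
        have : 0 ≤ ‖α - 1‖ / D := by positivity
        nlinarith
      have h9 : ‖((α - 1) / (r : ℂ) ^ 2) • e + (r : ℂ)⁻¹ • (z - α • e)‖ ^ 2 < 2 ^ 2 := by
        rw [hn]; linarith
      exact lt_of_pow_lt_pow_left₀ 2 (by norm_num) h9
    · rw [anisoScale_apply, pairing_add_left, pairing_smul_left, pairing_smul_left, hw, h11]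
      have e1 : (r : ℂ) • (((α - 1) / (r : ℂ) ^ 2) • e + (r : ℂ)⁻¹ • (z - α • e)
          - (((1 - r : ℝ) : ℂ) * ((α - 1) / (r : ℂ) ^ 2 * 1 + (r : ℂ)⁻¹ * 0)) • e)
          = ((r : ℂ) * ((α - 1) / (r : ℂ) ^ 2 - ((1 - r : ℝ) : ℂ) * ((α - 1) / (r : ℂ) ^ 2))) • e
            + ((r : ℂ) * (r : ℂ)⁻¹) • (z - α • e) := by
        module
      rw [e1, mul_inv_cancel₀ hrc]
      have e2 : (r : ℂ) * ((α - 1) / (r : ℂ) ^ 2 - ((1 - r : ℝ) : ℂ) * ((α - 1) / (r : ℂ) ^ 2))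
          = α - 1 := by
        push_cast; field_simp; ring
      rw [e2]; module
  calc volume {z ∈ unitBall n | koranyi z e < D}
      ≤ volume ((fun x => e + x) '' (anisoScale e r '' Metric.ball 0 2)) := measure_mono hsub
    _ = _ := by
      rw [show (fun x => e + x) = (fun x => e +ᵥ x) from rfl, Set.image_vadd, measure_vadd,
        volume_image_anisoScale he, hr2]

theorem volume_koranyi_le (hn : 1 ≤ n) {a : Cn n} (ha : ‖a‖ ≤ 1) {D : ℝ} (hD : 0 < D) :
    volume {z ∈ unitBall n | koranyi z a < D}
      ≤ ENNReal.ofReal ((2 * D) ^ (n + 1)) * volume (Metric.ball (0 : Cn n) 2) := by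
  obtain ⟨e, he, hae⟩ := exists_unit_direction hn a
  refine (measure_mono ?_).trans (volume_koranyi_unit_le he (D := 2 * D) (by linarith))
  rintro z ⟨hz, hzD⟩
  refine ⟨hz, ?_⟩
  have := koranyi_unit_le he hae ha (z := z) (by simpa using (mem_ball_zero_iff.1 hz).le)
  linarith

end Anisotropic

/-! ### Averaging over radial dilations. -/

section Averaging

variable {n : ℕ}

theorem lintegral_ball_eq_smul {τ : ℝ} (hτ : 0 < τ) (F : Cn n → ℝ≥0∞) :
    ∫⁻ z in unitBall n, F z
      = ENNReal.ofReal (τ ^ Module.finrank ℝ (Cn n))⁻¹ *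
        ∫⁻ u in Metric.ball (0 : Cn n) τ, F (τ⁻¹ • u) := by
  have hemb : MeasurableEmbedding (fun u : Cn n => τ⁻¹ • u) :=
    (Homeomorph.smulOfNeZero τ⁻¹ (inv_ne_zero hτ.ne')).measurableEmbedding
  have hmap := Measure.map_addHaar_smul (volume : Measure (Cn n)) (inv_ne_zero hτ.ne')
  have h1 : ∫⁻ u in Metric.ball (0 : Cn n) τ, F (τ⁻¹ • u)
      = ∫⁻ z in unitBall n, F z ∂(Measure.map (fun u : Cn n => τ⁻¹ • u) volume) := by
    rw [hemb.restrict_map, hemb.lintegral_map]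
    congr 2
    ext u
    simp only [Set.mem_preimage, mem_ball_zero_iff, norm_smul, norm_inv,
      Real.norm_of_nonneg hτ.le]
    rw [inv_mul_lt_iff₀ hτ, mul_one]
  rw [h1]
  change _ = _ * ∫⁻ z in unitBall n, F z ∂(Measure.map (τ⁻¹ • ·) volume)
  rw [hmap, Measure.restrict_smul, lintegral_smul_measure, smul_eq_mul, ← mul_assoc,
    ← ENNReal.ofReal_mul (by positivity), abs_of_pos (by positivity)]
  have : (τ ^ Module.finrank ℝ (Cn n))⁻¹ * (τ⁻¹ ^ Module.finrank ℝ (Cn n))⁻¹ = 1 := by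
    rw [inv_pow, inv_inv, inv_mul_cancel₀ (by positivity)]
  rw [this]; simp

/-- Substitute `z = u/τ` for fixed `τ`, with Jacobian at most `2^d` because `τ > 1/2`, and swap.
This plays the role of polar coordinates: for fixed `u`, a weight singular at `|z| = 1` becomes a
one-dimensional integral of a power of `τ - |u|`. -/
theorem lintegral_radial_average_le {G : ℝ → Cn n → ℝ≥0∞} (hG : Measurable (Function.uncurry G)) :
    ∫⁻ z in unitBall n, ∫⁻ τ in Set.Ioo (1 / 2 : ℝ) 1, G τ z
      ≤ ENNReal.ofReal (2 ^ Module.finrank ℝ (Cn n)) *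
        ∫⁻ u in unitBall n, ∫⁻ τ in Set.Ioo (max (1 / 2) ‖u‖) 1, G τ (τ⁻¹ • u) := by
  have hG' : Measurable (fun x : ℝ × Cn n => G x.1 (x.1⁻¹ • x.2)) :=
    hG.comp (measurable_fst.prodMk (measurable_fst.inv.smul measurable_snd))
  rw [lintegral_lintegral_swap (f := fun z τ => G τ z)
    (by exact (hG.comp measurable_swap).aemeasurable)]
  have hA : MeasurableSet {x : ℝ × Cn n | ‖x.2‖ < x.1} :=
    measurableSet_lt measurable_snd.norm measurable_fst
  calc ∫⁻ τ in Set.Ioo (1 / 2 : ℝ) 1, ∫⁻ z in unitBall n, G τ z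
      ≤ ∫⁻ τ in Set.Ioo (1 / 2 : ℝ) 1, ENNReal.ofReal (2 ^ Module.finrank ℝ (Cn n)) *
          ∫⁻ u in unitBall n, {x : ℝ × Cn n | ‖x.2‖ < x.1}.indicator
            (fun x => G x.1 (x.1⁻¹ • x.2)) (τ, u) := by
        refine setLIntegral_mono' measurableSet_Ioo fun τ hτ => ?_
        have hτ0 : 0 < τ := by have := hτ.1; linarith
        rw [lintegral_ball_eq_smul hτ0]
        refine mul_le_mul' (ENNReal.ofReal_le_ofReal ?_) ?_
        · rw [← inv_pow]
          refine pow_le_pow_left₀ (by positivity) ?_ _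
          rw [inv_le_comm₀ hτ0 (by norm_num)]; linarith [hτ.1]
        · rw [← lintegral_indicator Metric.isOpen_ball.measurableSet,
            ← lintegral_indicator Metric.isOpen_ball.measurableSet]
          refine lintegral_mono fun u => ?_
          by_cases hu : ‖u‖ < τ
          · have h1 : u ∈ Metric.ball (0 : Cn n) τ := by simpa using hu
            have h2 : u ∈ unitBall n := by simpa using hu.trans hτ.2
            simp [Set.indicator, h2, hu]
          · simp [Set.indicator, hu]
    _ = ENNReal.ofReal (2 ^ Module.finrank ℝ (Cn n)) *
          ∫⁻ τ in Set.Ioo (1 / 2 : ℝ) 1, ∫⁻ u in unitBall n,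
            {x : ℝ × Cn n | ‖x.2‖ < x.1}.indicator (fun x => G x.1 (x.1⁻¹ • x.2)) (τ, u) := by
        rw [lintegral_const_mul']; exact ENNReal.ofReal_ne_top
    _ = _ := by
        rw [lintegral_lintegral_swap (by exact (hG'.indicator hA).aemeasurable)]
        congr 1
        refine lintegral_congr fun u => ?_
        rw [← lintegral_indicator measurableSet_Ioo, ← lintegral_indicator measurableSet_Ioo]
        refine lintegral_congr fun τ => ?_
        by_cases h1 : ‖u‖ < τ <;> by_cases h2 : 1 / 2 < τ <;> by_cases h3 : τ < 1 <;>
          simp [Set.indicator, h1, h3, -one_div, h2]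

end Averaging

/-! ### Integrals of powers from the measure of sublevel sets. -/

section Dyadic

variable {α : Type*} [MeasurableSpace α]

/-- Cut into layers `2^k y ≤ X < 2^(k+1) y`. The layers contribute a geometric series of ratio
`2^(κ-β) < 1`, dominated by the smallest scale `y`. -/
theorem lintegral_rpow_neg_le_of_measure_lt_le {κ β : ℝ} (hβ : 0 ≤ β) (hκβ : κ < β) :
    ∃ C : ℝ≥0∞, C ≠ ⊤ ∧ ∀ (μ : Measure α) (X : α → ℝ) (A : ℝ≥0∞) (y : ℝ), Measurable X → 0 < y →
      (∀ᵐ x ∂μ, y ≤ X x) → (∀ D, 0 < D → μ {x | X x < D} ≤ A * ENNReal.ofReal (D ^ κ)) →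
      ∫⁻ x, ENNReal.ofReal (X x ^ (-β)) ∂μ ≤ C * A * ENNReal.ofReal (y ^ (κ - β)) := by
  have hr : ENNReal.ofReal ((2 : ℝ) ^ (κ - β)) < 1 := by
    rw [← ENNReal.ofReal_one]
    exact (ENNReal.ofReal_lt_ofReal_iff one_pos).2
      (Real.rpow_lt_one_of_one_lt_of_neg one_lt_two (by linarith))
  refine ⟨ENNReal.ofReal (2 ^ κ) * ∑' k : ℕ, ENNReal.ofReal ((2 : ℝ) ^ (κ - β)) ^ k,
    ENNReal.mul_ne_top ENNReal.ofReal_ne_top ?_, ?_⟩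
  · rw [ENNReal.tsum_geometric]
    exact ENNReal.inv_ne_top.2 (tsub_pos_of_lt hr).ne'
  intro μ X A y hX hy hyX hA
  have hms : ∀ D, MeasurableSet {x | X x < D} := fun D => measurableSet_lt hX measurable_const
  calc ∫⁻ x, ENNReal.ofReal (X x ^ (-β)) ∂μ
      ≤ ∫⁻ x, ∑' k : ℕ, {x | X x < 2 ^ (k + 1) * y}.indicator
          (fun _ => ENNReal.ofReal ((2 ^ k * y) ^ (-β))) x ∂μ := by
        refine lintegral_mono_ae ?_
        filter_upwards [hyX] with x hx
        obtain ⟨k, hk1, hk2⟩ := exists_nat_pow_near ((one_le_div hy).2 hx) one_lt_two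
        rw [le_div_iff₀ hy] at hk1
        rw [div_lt_iff₀ hy] at hk2
        refine le_trans ?_ (ENNReal.le_tsum k)
        rw [Set.indicator_of_mem (by exact hk2)]
        exact ENNReal.ofReal_le_ofReal
          (Real.rpow_le_rpow_of_nonpos (by positivity) hk1 (by linarith))
    _ = ∑' k : ℕ, ENNReal.ofReal ((2 ^ k * y) ^ (-β)) * μ {x | X x < 2 ^ (k + 1) * y} := by
        rw [lintegral_tsum fun k => (measurable_const.indicator (hms _)).aemeasurable]
        refine tsum_congr fun k => ?_
        rw [lintegral_indicator_const (hms _)]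
    _ ≤ ∑' k : ℕ, ENNReal.ofReal (2 ^ κ) * A * ENNReal.ofReal (y ^ (κ - β)) *
          ENNReal.ofReal ((2 : ℝ) ^ (κ - β)) ^ k := by
        refine ENNReal.tsum_le_tsum fun k => ?_
        refine (mul_le_mul_right (hA _ (by positivity)) _).trans (le_of_eq ?_)
        rw [← ENNReal.ofReal_pow (by positivity)]
        have : (2 ^ k * y) ^ (-β) * (2 ^ (k + 1) * y) ^ κ
            = 2 ^ κ * y ^ (κ - β) * ((2 : ℝ) ^ (κ - β)) ^ k := by
          rw [Real.mul_rpow (by positivity) hy.le, Real.mul_rpow (by positivity) hy.le,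
            ← Real.rpow_natCast, ← Real.rpow_natCast, ← Real.rpow_natCast,
            ← Real.rpow_mul (by norm_num), ← Real.rpow_mul (by norm_num),
            ← Real.rpow_mul (by norm_num), sub_eq_add_neg, Real.rpow_add hy]
          have : (2 : ℝ) ^ ((κ + -β) * (k : ℝ)) * 2 ^ κ
              = 2 ^ (↑k * -β) * 2 ^ (((k + 1 : ℕ) : ℝ) * κ) := by
            rw [← Real.rpow_add two_pos, ← Real.rpow_add two_pos]
            congr 1; push_cast; ring
          linear_combination (-(y ^ κ * y ^ (-β))) * this
        rw [mul_left_comm, ← ENNReal.ofReal_mul (by positivity), this,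
          ENNReal.ofReal_mul (by positivity), ENNReal.ofReal_mul (by positivity)]
        ring
    _ = _ := by rw [ENNReal.tsum_mul_left]; ring

/-- The subcritical companion: layers shrink towards `X = 0`, and the largest scale `D₀` dominates.
-/
theorem setLIntegral_rpow_neg_le_of_measure_lt_le {κ β : ℝ} (hβ : 0 ≤ β) (hκβ : β < κ) :
    ∃ C : ℝ≥0∞, C ≠ ⊤ ∧ ∀ (μ : Measure α) (X : α → ℝ) (A : ℝ≥0∞) (D₀ : ℝ), Measurable X → 0 < D₀ →
      (∀ᵐ x ∂μ, 0 < X x) → (∀ D, 0 < D → μ {x | X x < D} ≤ A * ENNReal.ofReal (D ^ κ)) →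
      ∫⁻ x in {x | X x < D₀}, ENNReal.ofReal (X x ^ (-β)) ∂μ
        ≤ C * A * ENNReal.ofReal (D₀ ^ (κ - β)) := by
  have hr : ENNReal.ofReal ((2⁻¹ : ℝ) ^ (κ - β)) < 1 := by
    rw [← ENNReal.ofReal_one]
    exact (ENNReal.ofReal_lt_ofReal_iff one_pos).2
      (Real.rpow_lt_one (by norm_num) (by norm_num) (by linarith))
  refine ⟨ENNReal.ofReal (2 ^ (κ + β)) * ∑' k : ℕ, ENNReal.ofReal ((2⁻¹ : ℝ) ^ (κ - β)) ^ k,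
    ENNReal.mul_ne_top ENNReal.ofReal_ne_top ?_, ?_⟩
  · rw [ENNReal.tsum_geometric]
    exact ENNReal.inv_ne_top.2 (tsub_pos_of_lt hr).ne'
  intro μ X A D₀ hX hD₀ hX0 hA
  have hms : ∀ D, MeasurableSet {x | X x < D} := fun D => measurableSet_lt hX measurable_const
  calc ∫⁻ x in {x | X x < D₀}, ENNReal.ofReal (X x ^ (-β)) ∂μ
      -- The layer is `2^(-k-1) D₀ < X ≤ 2^(-k) D₀`; doubling its upper end gives a strict sublevel
      -- set, the only kind the hypothesis measures.
      ≤ ∫⁻ x in {x | X x < D₀}, ∑' k : ℕ, {x | X x < 2 * (2⁻¹ ^ k * D₀)}.indicator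
          (fun _ => ENNReal.ofReal ((2⁻¹ * (2⁻¹ ^ k * D₀)) ^ (-β))) x ∂μ := by
        refine lintegral_mono_ae ?_
        filter_upwards [ae_restrict_of_ae hX0, ae_restrict_mem (hms _)] with x hx0 hx
        have hx' : X x < D₀ := hx
        obtain ⟨k, hk1, hk2⟩ := exists_nat_pow_near_of_lt_one (x := X x / D₀)
          (y := (2⁻¹ : ℝ)) (by positivity) ((div_le_one hD₀).2 hx'.le) (by norm_num) (by norm_num)
        rw [lt_div_iff₀ hD₀] at hk1
        rw [div_le_iff₀ hD₀] at hk2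
        refine le_trans ?_ (ENNReal.le_tsum k)
        rw [Set.indicator_of_mem (by
          have : 0 < (2⁻¹ : ℝ) ^ k * D₀ := by positivity
          simp only [Set.mem_ofPred_eq]; linarith)]
        refine ENNReal.ofReal_le_ofReal
          (Real.rpow_le_rpow_of_nonpos (by positivity) ?_ (by linarith))
        rw [pow_succ] at hk1; linarith
    _ = ∑' k : ℕ, ENNReal.ofReal ((2⁻¹ * (2⁻¹ ^ k * D₀)) ^ (-β)) *
          μ.restrict {x | X x < D₀} {x | X x < 2 * (2⁻¹ ^ k * D₀)} := by
        rw [lintegral_tsum fun k => (measurable_const.indicator (hms _)).aemeasurable]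
        refine tsum_congr fun k => ?_
        rw [lintegral_indicator_const (hms _)]
    _ ≤ ∑' k : ℕ, ENNReal.ofReal (2 ^ (κ + β)) * A * ENNReal.ofReal (D₀ ^ (κ - β)) *
          ENNReal.ofReal ((2⁻¹ : ℝ) ^ (κ - β)) ^ k := by
        refine ENNReal.tsum_le_tsum fun k => ?_
        refine (mul_le_mul_right ((Measure.restrict_apply_le _ _).trans
          (hA _ (by positivity))) _).trans (le_of_eq ?_)
        rw [← ENNReal.ofReal_pow (by positivity)]
        have h2 : (2⁻¹ : ℝ) ^ (-β) = 2 ^ β := by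
          rw [Real.inv_rpow (by norm_num), Real.rpow_neg (by norm_num), inv_inv]
        have : (2⁻¹ * (2⁻¹ ^ k * D₀)) ^ (-β) * (2 * (2⁻¹ ^ k * D₀)) ^ κ
            = 2 ^ (κ + β) * D₀ ^ (κ - β) * ((2⁻¹ : ℝ) ^ (κ - β)) ^ k := by
          have hk : (0 : ℝ) < 2⁻¹ ^ k := by positivity
          rw [Real.mul_rpow (by positivity) (by positivity),
            Real.mul_rpow (by positivity) (by positivity),
            Real.mul_rpow (by positivity) (by positivity),
            Real.mul_rpow (by positivity) (by positivity), h2, Real.rpow_add two_pos,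
            sub_eq_add_neg, Real.rpow_add hD₀]
          have h3 : ((2⁻¹ : ℝ) ^ (κ + -β)) ^ k = ((2⁻¹ : ℝ) ^ k) ^ (-β) * ((2⁻¹ : ℝ) ^ k) ^ κ := by
            rw [← Real.rpow_add hk, ← Real.rpow_natCast, ← Real.rpow_natCast,
              ← Real.rpow_mul (by norm_num), ← Real.rpow_mul (by norm_num)]
            congr 1; ring
          rw [h3]; ring
        rw [mul_left_comm, ← ENNReal.ofReal_mul (by positivity), this,
          ENNReal.ofReal_mul (by positivity), ENNReal.ofReal_mul (by positivity)]
        ring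
    _ = _ := by rw [ENNReal.tsum_mul_left]; ring

end Dyadic

/-! ### Weighted volume of nonisotropic balls and Forelli–Rudin estimates. -/

section ForelliRudin

variable {n : ℕ}

/-- The measure `(1 - |z|²)^t dz` on the unit ball. -/
noncomputable def powMeasure (n : ℕ) (t : ℝ) : Measure (Cn n) :=
  (volume.restrict (unitBall n)).withDensity fun z => ENNReal.ofReal ((1 - ‖z‖ ^ 2) ^ t)

theorem measurable_ofReal_one_sub_norm_sq_rpow (t : ℝ) :
    Measurable fun z : Cn n => ENNReal.ofReal ((1 - ‖z‖ ^ 2) ^ t) := by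
  fun_prop

theorem lintegral_powMeasure (t : ℝ) (F : Cn n → ℝ≥0∞) :
    ∫⁻ z, F z ∂(powMeasure n t)
      = ∫⁻ z in unitBall n, ENNReal.ofReal ((1 - ‖z‖ ^ 2) ^ t) * F z := by
  rw [powMeasure, lintegral_withDensity_eq_lintegral_mul_non_measurable _
    (measurable_ofReal_one_sub_norm_sq_rpow t) (Filter.Eventually.of_forall fun _ =>
      ENNReal.ofReal_lt_top)]
  rfl

theorem ae_powMeasure_mem (t : ℝ) : ∀ᵐ z ∂(powMeasure n t), z ∈ unitBall n :=
  (withDensity_absolutelyContinuous _ _).ae_le (ae_restrict_mem Metric.isOpen_ball.measurableSet)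

theorem lintegral_Ioo_sub_rpow {t M : ℝ} (ht : -1 < t) (hM : M ≤ 1) :
    ∫⁻ τ in Set.Ioo M 1, ENNReal.ofReal ((τ - M) ^ t)
      = ENNReal.ofReal ((1 - M) ^ (t + 1) / (t + 1)) := by
  have hint : IntervalIntegrable (fun τ : ℝ => (τ - M) ^ t) volume M 1 := by
    have := (intervalIntegral.intervalIntegrable_rpow' (a := 0) (b := 1 - M) ht).comp_sub_right M
    simpa using this
  have h1 : ∫ τ in M..1, (τ - M) ^ t = (1 - M) ^ (t + 1) / (t + 1) := by
    rw [intervalIntegral.integral_comp_sub_right (fun x => x ^ t) M, integral_rpow (Or.inl ht)]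
    rw [sub_self, Real.zero_rpow (by linarith), sub_zero]
  rw [← h1, intervalIntegral.integral_of_le hM,
    ofReal_integral_eq_lintegral_ofReal ((intervalIntegrable_iff_integrableOn_Ioc_of_le hM).1 hint)]
  · exact setLIntegral_congr Ioo_ae_eq_Ioc
  · filter_upwards [ae_restrict_mem measurableSet_Ioc] with τ hτ
    exact Real.rpow_nonneg (by linarith [hτ.1]) _

theorem measurableSet_koranyi_lt (a : Cn n) (D : ℝ) : MeasurableSet {z | koranyi z a < D} :=
  measurableSet_lt (continuous_koranyi_left a).measurable measurable_const

theorem powMeasure_koranyi_lt (a : Cn n) (D t : ℝ) :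
    powMeasure n t {z | koranyi z a < D}
      = ∫⁻ z in unitBall n, {z | koranyi z a < D}.indicator
          (fun z => ENNReal.ofReal ((1 - ‖z‖ ^ 2) ^ t)) z := by
  rw [powMeasure, withDensity_apply _ (measurableSet_koranyi_lt a D),
    lintegral_indicator (measurableSet_koranyi_lt a D)]

theorem powMeasure_koranyi_le_of_nonneg (hn : 1 ≤ n) {t : ℝ} (ht : 0 ≤ t) :
    ∃ C : ℝ≥0∞, C ≠ ⊤ ∧ ∀ (a : Cn n) (D : ℝ), ‖a‖ ≤ 1 → 0 < D →
      powMeasure n t {z | koranyi z a < D} ≤ C * ENNReal.ofReal (D ^ (n + 1 + t)) := by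
  refine ⟨ENNReal.ofReal (2 ^ t * 2 ^ (n + 1)) * volume (Metric.ball (0 : Cn n) 2),
    ENNReal.mul_ne_top ENNReal.ofReal_ne_top measure_ball_lt_top.ne, fun a D ha hD => ?_⟩
  rw [powMeasure_koranyi_lt]
  calc _ ≤ ∫⁻ z in unitBall n, {z | koranyi z a < D}.indicator
          (fun z => ENNReal.ofReal ((2 * D) ^ t)) z := by
        refine setLIntegral_mono' Metric.isOpen_ball.measurableSet fun z hz => ?_
        have hz1 := mem_ball_zero_iff.1 hz
        by_cases h : koranyi z a < D
        · rw [Set.indicator_of_mem (by exact h), Set.indicator_of_mem (by exact h)]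
          have := one_sub_norm_left_le_koranyi (z := z) ha
          exact ENNReal.ofReal_le_ofReal (Real.rpow_le_rpow (by nlinarith [norm_nonneg z])
            (by nlinarith [norm_nonneg z]) ht)
        · simp [h]
    _ = ENNReal.ofReal ((2 * D) ^ t) * volume {z ∈ unitBall n | koranyi z a < D} := by
        rw [lintegral_indicator_const (measurableSet_koranyi_lt a D),
          Measure.restrict_apply (measurableSet_koranyi_lt a D), Set.inter_comm]
        rfl
    _ ≤ ENNReal.ofReal ((2 * D) ^ t) * (ENNReal.ofReal ((2 * D) ^ (n + 1)) *
          volume (Metric.ball (0 : Cn n) 2)) := by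
        gcongr; exact volume_koranyi_le hn ha hD
    _ = _ := by
        have : (2 * D) ^ t * (2 * D) ^ (n + 1) = 2 ^ t * 2 ^ (n + 1) * D ^ (n + 1 + t) := by
          rw [Real.mul_rpow (by norm_num) hD.le, Real.rpow_add hD, mul_pow]
          have : D ^ ((n : ℝ) + 1) = D ^ (n + 1) := by exact_mod_cast Real.rpow_natCast D (n + 1)
          rw [this]; ring
        rw [← mul_assoc, ← ENNReal.ofReal_mul (by positivity), this,
          ENNReal.ofReal_mul (by positivity)]
        ring

theorem inv_smul_sub_norm_le {τ : ℝ} (hτ : 0 < τ) (hτ1 : τ ≤ 1) {u : Cn n} (hu : ‖u‖ ≤ τ) :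
    ‖u - τ⁻¹ • u‖ ≤ 1 - τ := by
  have : u - τ⁻¹ • u = (-(1 - τ)) • τ⁻¹ • u := by
    rw [smul_smul]
    have h : -(1 - τ) * τ⁻¹ = 1 - τ⁻¹ := by field_simp; ring
    rw [h, sub_smul, one_smul]
  rw [this, norm_smul, norm_neg, Real.norm_of_nonneg (by linarith), norm_smul, norm_inv,
    Real.norm_of_nonneg hτ.le]
  have : τ⁻¹ * ‖u‖ ≤ 1 := by rw [inv_mul_le_iff₀ hτ]; linarith
  nlinarith

theorem one_sub_norm_inv_smul_sq_bounds {τ : ℝ} (hτ : 1 / 2 < τ) (hτ1 : τ < 1) {u : Cn n}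
    (hu : ‖u‖ < τ) :
    τ - ‖u‖ ≤ 1 - ‖τ⁻¹ • u‖ ^ 2 ∧ 1 - ‖τ⁻¹ • u‖ ^ 2 ≤ 4 * (τ - ‖u‖) := by
  have h0 : 0 < τ := by linarith
  have h1 : ‖τ⁻¹ • u‖ = ‖u‖ / τ := by
    rw [norm_smul, norm_inv, Real.norm_of_nonneg h0.le]; ring
  have h2 : 1 - ‖u‖ / τ = (τ - ‖u‖) / τ := by field_simp
  have h3 : ‖u‖ / τ < 1 := by rw [div_lt_one h0]; exact hu
  have h4 : 0 ≤ ‖u‖ / τ := by positivity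
  have h5 : τ - ‖u‖ ≤ (τ - ‖u‖) / τ := by
    rw [le_div_iff₀ h0]; nlinarith
  have h6 : (τ - ‖u‖) / τ ≤ 2 * (τ - ‖u‖) := by
    rw [div_le_iff₀ h0]; nlinarith
  rw [h1]
  constructor <;> nlinarith

/-- For `t < 0` the density is unbounded, so it is averaged over dilations `τ` in an interval of
length comparable to `D`. Integrability of `(τ - |u|)^t` for `t > -1` replaces the singular density
by a multiple of `D^t`, and the unweighted volume bound finishes. -/
theorem powMeasure_koranyi_le_of_neg (hn : 1 ≤ n) {t : ℝ} (ht : -1 < t) (ht0 : t ≤ 0) :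
    ∃ C : ℝ≥0∞, C ≠ ⊤ ∧ ∀ (a : Cn n) (D : ℝ), ‖a‖ ≤ 1 → 0 < D → D ≤ 2 →
      powMeasure n t {z | koranyi z a < D} ≤ C * ENNReal.ofReal (D ^ (n + 1 + t)) := by
  set d := Module.finrank ℝ (Cn n)
  refine ⟨ENNReal.ofReal (2 ^ d * ((4 : ℝ)⁻¹ ^ t / (t + 1)) * 4 ^ (n + 1)) *
      volume (Metric.ball (0 : Cn n) 2),
    ENNReal.mul_ne_top ENNReal.ofReal_ne_top measure_ball_lt_top.ne, fun a D ha hD hD2 => ?_⟩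
  -- With `D ≤ 2` this keeps `(1 - δ, 1)` inside `(1/2, 1)`, and a radial shift of at most `δ` stays
  -- in the set of radius `2 D`.
  set δ := D / 4 with hδ
  have hδ0 : 0 < δ := by positivity
  have ht1 : 0 < t + 1 := by linarith
  set G : ℝ → Cn n → ℝ≥0∞ := fun τ z => {x : ℝ × Cn n | 1 - δ < x.1 ∧ koranyi x.2 a < D}.indicator
    (fun x => ENNReal.ofReal ((1 - ‖x.2‖ ^ 2) ^ t)) (τ, z) with hGdef
  have hGm : Measurable (Function.uncurry G) := by
    have hset : MeasurableSet {x : ℝ × Cn n | 1 - δ < x.1 ∧ koranyi x.2 a < D} :=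
      (measurableSet_lt measurable_const measurable_fst).inter
        (measurableSet_lt ((continuous_koranyi_left a).measurable.comp measurable_snd)
          measurable_const)
    exact ((measurable_ofReal_one_sub_norm_sq_rpow t).comp measurable_snd).indicator hset
  have hleft : ∫⁻ z in unitBall n, ∫⁻ τ in Set.Ioo (1 / 2 : ℝ) 1, G τ z
      = ENNReal.ofReal δ * powMeasure n t {z | koranyi z a < D} := by
    rw [powMeasure_koranyi_lt, ← lintegral_const_mul' _ _ ENNReal.ofReal_ne_top]
    refine lintegral_congr fun z => ?_
    have : ∀ τ, G τ z = (Set.Ioi (1 - δ)).indicator (fun _ => {z | koranyi z a < D}.indicator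
        (fun z => ENNReal.ofReal ((1 - ‖z‖ ^ 2) ^ t)) z) τ := by
      intro τ
      by_cases h1 : 1 - δ < τ <;> by_cases h2 : koranyi z a < D <;>
        simp [hGdef, Set.indicator, h1, h2]
    simp_rw [this]
    rw [lintegral_indicator_const measurableSet_Ioi, Measure.restrict_apply measurableSet_Ioi,
      mul_comm]
    congr 1
    have : Set.Ioi (1 - δ) ∩ Set.Ioo (1 / 2) 1 = Set.Ioo (1 - δ) 1 := by
      ext x; simp only [Set.mem_inter_iff, Set.mem_Ioi, Set.mem_Ioo]
      constructor
      · rintro ⟨h1, h2, h3⟩; exact ⟨h1, h3⟩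
      · rintro ⟨h1, h2⟩; exact ⟨h1, by linarith, h2⟩
    rw [this, Real.volume_Ioo]; congr 1; ring
  have hright : ∫⁻ u in unitBall n, ∫⁻ τ in Set.Ioo (max (1 / 2) ‖u‖) 1, G τ (τ⁻¹ • u)
      ≤ ENNReal.ofReal (δ ^ (t + 1) / (t + 1)) *
        (ENNReal.ofReal ((2 * (2 * D)) ^ (n + 1)) * volume (Metric.ball (0 : Cn n) 2)) := by
    calc _ ≤ ∫⁻ u in unitBall n, {z | koranyi z a < 2 * D}.indicator
            (fun _ => ENNReal.ofReal (δ ^ (t + 1) / (t + 1))) u := by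
          refine setLIntegral_mono' Metric.isOpen_ball.measurableSet fun u hu => ?_
          have hu1 : ‖u‖ < 1 := mem_ball_zero_iff.1 hu
          -- Since `t ≤ 0` and `M ≥ |u|`, one may replace `τ - |u|` by `τ - M`; the interval `(M,
          -- 1)` has length at most `δ`, which yields `δ^(t+1)/(t+1)`.
          set M := max (1 - δ) ‖u‖ with hMdef
          have hM1 : M ≤ 1 := max_le (by linarith) hu1.le
          have hsm : 0 ≤ 1 - M := by linarith
          have key : ∀ τ ∈ Set.Ioo (max (1 / 2) ‖u‖) 1, G τ (τ⁻¹ • u) ≤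
              (Set.Ioo M 1).indicator (fun τ => {z | koranyi z a < 2 * D}.indicator
                (fun _ => ENNReal.ofReal ((τ - M) ^ t)) u) τ := by
            intro τ hτ
            obtain ⟨hτm, hτ1⟩ := hτ
            obtain ⟨hτh, hτu⟩ := max_lt_iff.1 hτm
            by_cases h1 : 1 - δ < τ
            · by_cases h2 : koranyi (τ⁻¹ • u) a < D
              · have h3 : koranyi u a < 2 * D := by
                  have e1 := koranyi_le_add u (τ⁻¹ • u) a
                  have e2 := inv_smul_sub_norm_le (by linarith) hτ1.le hτu.le
                  nlinarith [norm_nonneg (u - τ⁻¹ • u), norm_nonneg a]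
                have h4 : τ ∈ Set.Ioo M 1 := ⟨max_lt h1 hτu, hτ1⟩
                have h5 : ‖u‖ ≤ M := le_max_right _ _
                rw [Set.indicator_of_mem h4, Set.indicator_of_mem (by exact h3)]
                simp only [hGdef]
                rw [Set.indicator_of_mem (by exact ⟨h1, h2⟩)]
                refine ENNReal.ofReal_le_ofReal (Real.rpow_le_rpow_of_nonpos ?_ ?_ ht0)
                · linarith [h4.1]
                · linarith [(one_sub_norm_inv_smul_sq_bounds hτh hτ1 hτu).1]
              · simp [hGdef, h2]
            · simp [hGdef, h1]
          calc _ ≤ ∫⁻ τ in Set.Ioo (max (1 / 2) ‖u‖) 1, (Set.Ioo M 1).indicator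
                  (fun τ => {z | koranyi z a < 2 * D}.indicator
                    (fun _ => ENNReal.ofReal ((τ - M) ^ t)) u) τ :=
                setLIntegral_mono' measurableSet_Ioo key
            _ ≤ ∫⁻ τ in Set.Ioo M 1, {z | koranyi z a < 2 * D}.indicator
                    (fun _ => ENNReal.ofReal ((τ - M) ^ t)) u := by
                rw [← lintegral_indicator (μ := volume) (s := Set.Ioo M 1) measurableSet_Ioo]
                exact setLIntegral_le_lintegral _ _
            _ ≤ _ := by
                by_cases h : koranyi u a < 2 * D
                · simp only [Set.indicator, Set.mem_ofPred_eq, h, if_true]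
                  rw [lintegral_Ioo_sub_rpow ht hM1]
                  refine ENNReal.ofReal_le_ofReal ?_
                  have : 1 - M ≤ δ := by linarith [le_max_left (1 - δ) ‖u‖]
                  gcongr
                · simp [h]
      _ = ENNReal.ofReal (δ ^ (t + 1) / (t + 1)) * volume {z ∈ unitBall n | koranyi z a < 2 * D} := by
          rw [lintegral_indicator_const (measurableSet_koranyi_lt a _),
            Measure.restrict_apply (measurableSet_koranyi_lt a _), Set.inter_comm]
          rfl
      _ ≤ _ := by gcongr; exact volume_koranyi_le hn ha (by linarith)
  have hfin := hleft ▸ (lintegral_radial_average_le hGm).trans (mul_le_mul_right hright _)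
  have hδne : ENNReal.ofReal δ ≠ 0 := by simpa using hδ0
  rw [mul_comm] at hfin
  rw [← ENNReal.le_div_iff_mul_le (Or.inl hδne) (Or.inl ENNReal.ofReal_ne_top)] at hfin
  refine hfin.trans (le_of_eq ?_)
  rw [ENNReal.div_eq_inv_mul, ← ENNReal.ofReal_inv_of_pos hδ0, mul_assoc (ENNReal.ofReal _)
    (volume _), mul_comm (volume _), ← mul_assoc (ENNReal.ofReal _) (ENNReal.ofReal _) (volume _),
    ← mul_assoc, ← mul_assoc, ← mul_assoc, ← mul_assoc, ← ENNReal.ofReal_mul (by positivity),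
    ← ENNReal.ofReal_mul (by positivity), ← ENNReal.ofReal_mul (by positivity),
    ← mul_assoc (ENNReal.ofReal _) (ENNReal.ofReal _), ← ENNReal.ofReal_mul (by positivity)]
  congr 2
  have h1 : D ^ ((n : ℝ) + 1 + t) = D ^ (n + 1) * D ^ t := by
    rw [Real.rpow_add hD]; congr 1; exact_mod_cast Real.rpow_natCast D (n + 1)
  have h2 : δ ^ (t + 1) = δ * (4⁻¹ ^ t * D ^ t) := by
    rw [Real.rpow_add hδ0, Real.rpow_one, hδ, div_eq_inv_mul, Real.mul_rpow (by norm_num) hD.le]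
    ring
  rw [h1, h2]
  field_simp
  rw [mul_pow]; norm_num; ring

theorem powMeasure_koranyi_le (hn : 1 ≤ n) {t : ℝ} (ht : -1 < t) :
    ∃ C : ℝ≥0∞, C ≠ ⊤ ∧ ∀ (a : Cn n) (D : ℝ), ‖a‖ ≤ 1 → 0 < D →
      powMeasure n t {z | koranyi z a < D} ≤ C * ENNReal.ofReal (D ^ (n + 1 + t)) := by
  rcases le_or_gt 0 t with h0 | h0
  · exact powMeasure_koranyi_le_of_nonneg hn h0
  · obtain ⟨C, hC, hCD⟩ := powMeasure_koranyi_le_of_neg hn ht h0.le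
    refine ⟨C, hC, fun a D ha hD => ?_⟩
    rcases le_or_gt D 2 with h2 | h2
    · exact hCD a D ha hD h2
    -- The quasi-distance is always below `2`, so the set stops growing at `D = 2` while the bound
    -- does not.
    · calc powMeasure n t {z | koranyi z a < D}
          ≤ powMeasure n t {z | koranyi z a < 2} := by
            refine measure_mono_ae ?_
            filter_upwards [ae_powMeasure_mem (n := n) t] with z hz _
            exact koranyi_lt_two (mem_ball_zero_iff.1 hz) ha
        _ ≤ C * ENNReal.ofReal (2 ^ (n + 1 + t)) := hCD a 2 ha two_pos le_rfl
        _ ≤ _ := by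
            have : (0 : ℝ) ≤ n := Nat.cast_nonneg n
            gcongr
            linarith

/-- The Forelli–Rudin estimate. -/
theorem lintegral_koranyi_rpow_le (hn : 1 ≤ n) {t c : ℝ} (ht : -1 < t) (hc : 0 < c) :
    ∃ C : ℝ≥0∞, C ≠ ⊤ ∧ ∀ a : Cn n, ‖a‖ < 1 →
      ∫⁻ z, ENNReal.ofReal (koranyi z a ^ (-(n + 1 + t + c))) ∂(powMeasure n t)
        ≤ C * ENNReal.ofReal ((1 - ‖a‖ ^ 2) ^ (-c)) := by
  have hn0 : (0 : ℝ) ≤ n := Nat.cast_nonneg n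
  obtain ⟨C₁, hC₁, h₁⟩ := powMeasure_koranyi_le hn ht
  obtain ⟨C₂, hC₂, h₂⟩ := lintegral_rpow_neg_le_of_measure_lt_le (α := Cn n)
    (κ := n + 1 + t) (β := n + 1 + t + c) (by linarith) (by linarith)
  refine ⟨C₂ * C₁ * ENNReal.ofReal (2 ^ c), ENNReal.mul_ne_top (ENNReal.mul_ne_top hC₂ hC₁)
    ENNReal.ofReal_ne_top, fun a ha => ?_⟩
  have hy : 0 < 1 - ‖a‖ ^ 2 := by nlinarith [norm_nonneg a]
  -- The smallest scale comes from `|1-⟨z,a⟩| ≥ 1 - |a| ≥ (1 - |a|²)/2`.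
  refine (h₂ (powMeasure n t) (fun z => koranyi z a) C₁ ((1 - ‖a‖ ^ 2) / 2)
    (continuous_koranyi_left a).measurable (by linarith) ?_ (fun D hD => h₁ a D ha.le hD)).trans ?_
  · filter_upwards [ae_powMeasure_mem (n := n) t] with z hz
    have := one_sub_norm_right_le_koranyi (w := a) (mem_ball_zero_iff.1 hz).le
    nlinarith [norm_nonneg a]
  · rw [mul_assoc _ (ENNReal.ofReal (2 ^ c)), ← ENNReal.ofReal_mul (by positivity)]
    refine mul_le_mul_right (le_of_eq ?_) _
    congr 1
    rw [show (n : ℝ) + 1 + t - (n + 1 + t + c) = -c by ring, div_eq_mul_inv,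
      Real.mul_rpow hy.le (by norm_num), Real.inv_rpow (by norm_num), Real.rpow_neg two_pos.le,
      inv_inv, mul_comm]

theorem setLIntegral_koranyi_rpow_le (hn : 1 ≤ n) {t c : ℝ} (ht : -1 < t) (hc : 0 ≤ c)
    (hct : c < n + 1 + t) :
    ∃ C : ℝ≥0∞, C ≠ ⊤ ∧ ∀ (a : Cn n) (D : ℝ), ‖a‖ ≤ 1 → 0 < D →
      ∫⁻ z in {z | koranyi z a < D}, ENNReal.ofReal (koranyi z a ^ (-c)) ∂(powMeasure n t)
        ≤ C * ENNReal.ofReal (D ^ (n + 1 + t - c)) := by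
  obtain ⟨C₁, hC₁, h₁⟩ := powMeasure_koranyi_le hn ht
  obtain ⟨C₂, hC₂, h₂⟩ := setLIntegral_rpow_neg_le_of_measure_lt_le (α := Cn n)
    (κ := n + 1 + t) (β := c) hc hct
  refine ⟨C₂ * C₁, ENNReal.mul_ne_top hC₂ hC₁, fun a D ha hD => ?_⟩
  refine h₂ (powMeasure n t) (fun z => koranyi z a) C₁ D
    (continuous_koranyi_left a).measurable hD ?_ (fun D hD => h₁ a D ha hD)
  filter_upwards [ae_powMeasure_mem (n := n) t] with z hz
  exact koranyi_pos (mem_ball_zero_iff.1 hz) ha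

/-- By the quasi-triangle inequality `z` cannot be close to both `w` and `a`: one of the two
quasi-distances is at least `|1-⟨w,a⟩|/8`. Freezing that factor leaves a one-point integral, over
the whole ball in one case and near `a` in the other. -/
theorem koranyi_rpow_mul_rpow_le (hn : 1 ≤ n) {b c : ℝ} (hb : 0 ≤ b) (hc : 0 ≤ c)
    {z w a : Cn n} (hz : ‖z‖ < 1) (hw : ‖w‖ < 1) (ha : ‖a‖ < 1) :
    ENNReal.ofReal (koranyi z w ^ (-b) * koranyi z a ^ (-c))
      ≤ ENNReal.ofReal ((koranyi w a / 8) ^ (-c)) * ENNReal.ofReal (koranyi z w ^ (-b))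
        + ENNReal.ofReal ((koranyi w a / 8) ^ (-b)) * {z | koranyi z a < koranyi w a}.indicator
            (fun z => ENNReal.ofReal (koranyi z a ^ (-c))) z := by
  have hD := koranyi_pos hw ha.le
  have h1 := koranyi_pos hz hw.le
  have h2 := koranyi_pos hz ha.le
  have hq := koranyi_quasi_triangle hn hw ha hz.le
  rw [koranyi_comm w z] at hq
  by_cases h : koranyi w a / 8 ≤ koranyi z a
  · refine le_trans ?_ (self_le_add_right _ _)
    rw [mul_comm, ENNReal.ofReal_mul (by positivity)]
    gcongr ENNReal.ofReal ?_ * _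
    exact Real.rpow_le_rpow_of_nonpos (by positivity) h (by linarith)
  · refine le_trans ?_ (self_le_add_left _ _)
    rw [Set.indicator_of_mem (by simp only [Set.mem_ofPred_eq]; linarith),
      ENNReal.ofReal_mul (by positivity)]
    gcongr ENNReal.ofReal ?_ * _
    exact Real.rpow_le_rpow_of_nonpos (by positivity) (by linarith) (by linarith)

/-- The two-point Forelli–Rudin estimate. -/
theorem lintegral_koranyi_mul_koranyi_le (hn : 1 ≤ n) {t b c : ℝ} (ht : -1 < t) (hc : 0 ≤ c)
    (hct : c < n + 1 + t) (hbt : n + 1 + t < b) :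
    ∃ C : ℝ≥0∞, C ≠ ⊤ ∧ ∀ w a : Cn n, ‖w‖ < 1 → ‖a‖ < 1 →
      ∫⁻ z, ENNReal.ofReal (koranyi z w ^ (-b) * koranyi z a ^ (-c)) ∂(powMeasure n t)
        ≤ C * ENNReal.ofReal ((1 - ‖w‖ ^ 2) ^ (-(b - (n + 1 + t))) * koranyi w a ^ (-c)) := by
  obtain ⟨C₁, hC₁, h₁⟩ := lintegral_koranyi_rpow_le hn (c := b - (n + 1 + t)) ht (by linarith)
  obtain ⟨C₂, hC₂, h₂⟩ := setLIntegral_koranyi_rpow_le hn ht hc hct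
  set e := b - (n + 1 + t) with he
  refine ⟨C₁ * ENNReal.ofReal (8 ^ c) + C₂ * ENNReal.ofReal (8 ^ b * 2 ^ e), by finiteness,
    fun w a hw ha => ?_⟩
  have hD := koranyi_pos hw ha.le
  have hw2 : 0 < 1 - ‖w‖ ^ 2 := by nlinarith [norm_nonneg w]
  have hdiv : ∀ x : ℝ, (koranyi w a / 8) ^ (-x) = 8 ^ x * koranyi w a ^ (-x) := fun x => by
    rw [div_eq_mul_inv, Real.mul_rpow hD.le (by norm_num), Real.inv_rpow (by norm_num),
      Real.rpow_neg (by norm_num : (0 : ℝ) ≤ 8), inv_inv, mul_comm]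
  have hm1 : Measurable fun z : Cn n => ENNReal.ofReal (koranyi z w ^ (-b)) :=
    ((continuous_koranyi_left w).measurable.pow_const _).ennreal_ofReal
  calc _ ≤ ∫⁻ z, (ENNReal.ofReal ((koranyi w a / 8) ^ (-c)) * ENNReal.ofReal (koranyi z w ^ (-b))
        + ENNReal.ofReal ((koranyi w a / 8) ^ (-b)) * {z | koranyi z a < koranyi w a}.indicator
            (fun z => ENNReal.ofReal (koranyi z a ^ (-c))) z) ∂(powMeasure n t) := by
        refine lintegral_mono_ae ?_
        filter_upwards [ae_powMeasure_mem (n := n) t] with z hz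
        exact koranyi_rpow_mul_rpow_le hn (by linarith) hc (mem_ball_zero_iff.1 hz) hw ha
    _ = ENNReal.ofReal ((koranyi w a / 8) ^ (-c)) *
          ∫⁻ z, ENNReal.ofReal (koranyi z w ^ (-b)) ∂(powMeasure n t)
        + ENNReal.ofReal ((koranyi w a / 8) ^ (-b)) *
          ∫⁻ z in {z | koranyi z a < koranyi w a},
            ENNReal.ofReal (koranyi z a ^ (-c)) ∂(powMeasure n t) := by
        rw [lintegral_add_left (hm1.const_mul _), lintegral_const_mul' _ _ ENNReal.ofReal_ne_top,
          lintegral_const_mul' _ _ ENNReal.ofReal_ne_top,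
          lintegral_indicator (measurableSet_koranyi_lt a _)]
    _ ≤ ENNReal.ofReal ((koranyi w a / 8) ^ (-c)) *
          (C₁ * ENNReal.ofReal ((1 - ‖w‖ ^ 2) ^ (-e)))
        + ENNReal.ofReal ((koranyi w a / 8) ^ (-b)) *
          (C₂ * ENNReal.ofReal (koranyi w a ^ (n + 1 + t - c))) := by
        have := h₁ w hw
        rw [show (n : ℝ) + 1 + t + e = b by rw [he]; ring] at this
        exact add_le_add (mul_le_mul_right this _) (mul_le_mul_right (h₂ a _ ha.le hD) _)
    _ ≤ _ := by
        rw [add_mul]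
        refine add_le_add (le_of_eq ?_) ?_
        · rw [mul_left_comm, ← ENNReal.ofReal_mul (by positivity), mul_assoc,
            ← ENNReal.ofReal_mul (by positivity), hdiv]
          congr 2; ring
        · rw [mul_left_comm, ← ENNReal.ofReal_mul (by positivity), mul_assoc,
            ← ENNReal.ofReal_mul (by positivity)]
          refine mul_le_mul_right (ENNReal.ofReal_le_ofReal ?_) _
          have h3 : koranyi w a ^ (-b) * koranyi w a ^ (n + 1 + t - c)
              = koranyi w a ^ (-e) * koranyi w a ^ (-c) := by
            rw [← Real.rpow_add hD, ← Real.rpow_add hD]; congr 1; rw [he]; ring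
          -- In the region near `a` the powers of `|1-⟨w,a⟩|` add up to `-e - c`; the surplus `-e`
          -- is traded for a power of `1 - |w|²`.
          have h4 : koranyi w a ^ (-e) ≤ 2 ^ e * (1 - ‖w‖ ^ 2) ^ (-e) := by
            have h5 := one_sub_norm_left_le_koranyi (z := w) ha.le
            have : koranyi w a ^ (-e) ≤ ((1 - ‖w‖ ^ 2) / 2) ^ (-e) :=
              Real.rpow_le_rpow_of_nonpos (by positivity) (by nlinarith [norm_nonneg w])
                (by linarith)
            refine this.trans (le_of_eq ?_)
            rw [div_eq_mul_inv, Real.mul_rpow hw2.le (by norm_num), Real.inv_rpow (by norm_num),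
              Real.rpow_neg two_pos.le, inv_inv, mul_comm]
          rw [hdiv, mul_assoc, h3, mul_assoc, ← mul_assoc (2 ^ e)]
          gcongr

end ForelliRudin

/-! ### Both conditions as uniform bounds on Möbius integrals. -/

section Reformulation

variable {n : ℕ}

/-- The integral `∫ F(z) (1 - |a|²)^c |1 - ⟨z, a⟩|^(-2c) (1 - |z|²)^t dz` over the unit ball. -/
noncomputable def moebiusIntegral (t c : ℝ) (F : Cn n → ℝ≥0∞) (a : Cn n) : ℝ≥0∞ :=
  ∫⁻ z, F z * ENNReal.ofReal ((1 - ‖a‖ ^ 2) ^ c * koranyi z a ^ (-(2 * c))) ∂(powMeasure n t)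

/-- The `p`-th power of the mean oscillation, with respect to the unnormalized volume. -/
noncomputable def oscIntegral (p : ℝ) (f : Cn n → ℂ) (z : Cn n) : ℝ≥0∞ :=
  ∫⁻ w in unitBall n, ‖f z - f w‖ₑ ^ p *
    ENNReal.ofReal ((1 - ‖z‖ ^ 2) ^ (n + 1) * koranyi z w ^ (-(2 * ((n : ℝ) + 1))))

theorem volume_unitBall_inv_ne_top : (volume (unitBall n))⁻¹ ≠ ⊤ :=
  ENNReal.inv_ne_top.2 (Metric.measure_ball_pos _ _ one_pos).ne'

/-- `one_sub_norm_Phi_sq` lets the powers of `1 - |z|²` from the weight and from `dλ` merge into the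
single exponent `q + n s - n - 1`. -/
theorem lintegral_weight_invMeasure (q s : ℝ) (F : Cn n → ℝ≥0∞) {a : Cn n} (ha : a ∈ unitBall n) :
    ∫⁻ z, F z * weight q s a z ∂(invMeasure n)
      = (volume (unitBall n))⁻¹ * moebiusIntegral (q + n * s - n - 1) (n * s) F a := by
  have ha1 : ‖a‖ < 1 := mem_ball_zero_iff.1 ha
  rw [invMeasure, lintegral_withDensity_eq_lintegral_mul_non_measurable _
    (measurable_ofReal_one_sub_norm_sq_rpow _) (Filter.Eventually.of_forall fun _ =>
      ENNReal.ofReal_lt_top), ballVolume, lintegral_smul_measure, smul_eq_mul, moebiusIntegral,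
    lintegral_powMeasure]
  congr 1
  refine setLIntegral_congr_fun Metric.isOpen_ball.measurableSet fun z hz => ?_
  have hz1 : ‖z‖ < 1 := mem_ball_zero_iff.1 hz
  have hz2 : 0 < 1 - ‖z‖ ^ 2 := by nlinarith [norm_nonneg z]
  have ha2 : 0 < 1 - ‖a‖ ^ 2 := by nlinarith [norm_nonneg a]
  have hk := koranyi_pos hz1 ha1.le
  simp only [Pi.mul_apply, weight]
  rw [one_sub_norm_Phi_sq ha1 hz1, mul_left_comm, mul_left_comm _ (F z),
    ← ENNReal.ofReal_mul (by positivity), ← ENNReal.ofReal_mul (by positivity)]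
  congr 2
  rw [Real.div_rpow (by positivity) (by positivity), Real.mul_rpow ha2.le hz2.le,
    ← Real.rpow_natCast (koranyi z a) 2, ← Real.rpow_mul hk.le,
    show q + n * s - n - 1 = (-(n : ℝ) - 1) + q + n * s by ring, Real.rpow_add hz2,
    Real.rpow_add hz2, Real.rpow_neg hk.le]
  push_cast
  ring

theorem iSup_lintegral_weight_lt_top_iff (q s : ℝ) (F : Cn n → ℝ≥0∞) :
    (⨆ a ∈ unitBall n, ∫⁻ z, F z * weight q s a z ∂(invMeasure n)) < ⊤ ↔
      ∃ C : ℝ≥0∞, C ≠ ⊤ ∧ ∀ a ∈ unitBall n,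
        moebiusIntegral (q + n * s - n - 1) (n * s) F a ≤ C := by
  constructor
  · intro h
    refine ⟨volume (unitBall n) * (⨆ a ∈ unitBall n, ∫⁻ z, F z * weight q s a z ∂(invMeasure n)),
      ENNReal.mul_ne_top measure_ball_lt_top.ne h.ne, fun a ha => ?_⟩
    have h1 := le_iSup₂ (f := fun a (_ : a ∈ unitBall n) =>
      ∫⁻ z, F z * weight q s a z ∂(invMeasure n)) a ha
    rw [lintegral_weight_invMeasure q s F ha] at h1
    refine le_trans (le_of_eq ?_) (mul_le_mul_right h1 _)
    rw [← mul_assoc, ENNReal.mul_inv_cancel (Metric.measure_ball_pos _ _ one_pos).ne'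
      measure_ball_lt_top.ne, one_mul]
  · rintro ⟨C, hC, h⟩
    refine lt_of_le_of_lt (iSup₂_le fun a ha => ?_)
      (ENNReal.mul_lt_top (volume_unitBall_inv_ne_top (n := n)).lt_top hC.lt_top)
    rw [lintegral_weight_invMeasure q s F ha]
    exact mul_le_mul_right (h a ha) _

theorem meanOsc_rpow {p : ℝ} (hp : 1 ≤ p) (f : Cn n → ℂ) (z : Cn n) :
    meanOsc p f z ^ p = (volume (unitBall n))⁻¹ * oscIntegral p f z := by
  rw [meanOsc, ← ENNReal.rpow_mul, one_div_mul_cancel (by linarith), ENNReal.rpow_one, ballVolume,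
    lintegral_smul_measure, smul_eq_mul, oscIntegral]
  congr 1
  refine lintegral_congr fun w => ?_
  congr 2
  rw [Real.rpow_neg (koranyi_nonneg z w), div_eq_mul_inv, koranyi]
  congr 2
  rw [← Real.rpow_natCast]; push_cast; rfl

theorem moebiusIntegral_const_mul (t c : ℝ) {A : ℝ≥0∞} (hA : A ≠ ⊤) (F : Cn n → ℝ≥0∞) (a : Cn n) :
    moebiusIntegral t c (fun z => A * F z) a = A * moebiusIntegral t c F a := by
  simp only [moebiusIntegral, mul_assoc]
  exact lintegral_const_mul' _ _ hA

theorem moebiusIntegral_congr (t c : ℝ) {F G : Cn n → ℝ≥0∞} (h : ∀ z ∈ unitBall n, F z = G z) :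
    moebiusIntegral t c F = moebiusIntegral t c G := by
  funext a
  refine lintegral_congr_ae ?_
  filter_upwards [ae_powMeasure_mem (n := n) t] with z hz
  rw [h z hz]

theorem moebiusIntegral_mono (t c : ℝ) {F G : Cn n → ℝ≥0∞} (h : ∀ z ∈ unitBall n, F z ≤ G z)
    (a : Cn n) : moebiusIntegral t c F a ≤ moebiusIntegral t c G a := by
  refine lintegral_mono_ae ?_
  filter_upwards [ae_powMeasure_mem (n := n) t] with z hz
  exact mul_le_mul_left (h z hz) _

theorem oscIntegral_congr (p : ℝ) {f g : Cn n → ℂ} (h : ∀ z ∈ unitBall n, f z = g z)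
    {z : Cn n} (hz : z ∈ unitBall n) : oscIntegral p f z = oscIntegral p g z := by
  refine setLIntegral_congr_fun Metric.isOpen_ball.measurableSet fun w hw => ?_
  simp only [h z hz, h w hw]

theorem oscFunctional_lt_top_iff {p : ℝ} (hp : 1 ≤ p) (q s : ℝ) (f : Cn n → ℂ) :
    oscFunctional p q s f < ⊤ ↔ ∃ C : ℝ≥0∞, C ≠ ⊤ ∧ ∀ a ∈ unitBall n,
      moebiusIntegral (q + n * s - n - 1) (n * s) (oscIntegral p f) a ≤ C := by
  rw [oscFunctional, iSup_lintegral_weight_lt_top_iff q s fun z => meanOsc p f z ^ p]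
  have hrw : ∀ a, moebiusIntegral (q + n * s - n - 1) (n * s) (fun z => meanOsc p f z ^ p) a
      = (volume (unitBall n))⁻¹ *
        moebiusIntegral (q + n * s - n - 1) (n * s) (oscIntegral p f) a := fun a => by
    simp_rw [meanOsc_rpow hp]
    exact moebiusIntegral_const_mul _ _ volume_unitBall_inv_ne_top _ _
  simp_rw [hrw]
  constructor
  · rintro ⟨C, hC, h⟩
    refine ⟨volume (unitBall n) * C, ENNReal.mul_ne_top measure_ball_lt_top.ne hC, fun a ha => ?_⟩
    refine le_trans (le_of_eq ?_) (mul_le_mul_right (h a ha) _)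
    rw [← mul_assoc, ENNReal.mul_inv_cancel (Metric.measure_ball_pos _ _ one_pos).ne'
      measure_ball_lt_top.ne, one_mul]
  · rintro ⟨C, hC, h⟩
    exact ⟨_, ENNReal.mul_ne_top volume_unitBall_inv_ne_top hC,
      fun a ha => mul_le_mul_right (h a ha) _⟩

theorem measurable_osc_integrand {p : ℝ} {f : Cn n → ℂ} (hf : Measurable f) :
    Measurable fun x : Cn n × Cn n => ‖f x.1 - f x.2‖ₑ ^ p *
      ENNReal.ofReal ((1 - ‖x.1‖ ^ 2) ^ (n + 1) * koranyi x.1 x.2 ^ (-(2 * ((n : ℝ) + 1)))) := by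
  have h1 := (continuous_koranyi (n := n)).measurable
  fun_prop

theorem measurable_oscIntegral {p : ℝ} {f : Cn n → ℂ} (hf : Measurable f) :
    Measurable (oscIntegral p f) :=
  (measurable_osc_integrand hf).lintegral_prod_right'

end Reformulation

/-! ### From integrability of `f` to its oscillation. -/

section OscillationBound

variable {n : ℕ}

/-- Forelli–Rudin with exponents `0` and `n + 1`: the factor `(1-|z|²)^(n+1)` cancels the bound
exactly. -/
theorem lintegral_berezin_kernel_le (hn : 1 ≤ n) :
    ∃ C : ℝ≥0∞, C ≠ ⊤ ∧ ∀ z ∈ unitBall n,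
      ∫⁻ w in unitBall n, ENNReal.ofReal
        ((1 - ‖z‖ ^ 2) ^ (n + 1) * koranyi z w ^ (-(2 * ((n : ℝ) + 1)))) ≤ C := by
  obtain ⟨C, hC, h⟩ := lintegral_koranyi_rpow_le hn (t := 0) (c := n + 1) (by norm_num)
    (by positivity)
  refine ⟨C, hC, fun z hz => ?_⟩
  have hz1 := mem_ball_zero_iff.1 hz
  have hz2 : 0 < 1 - ‖z‖ ^ 2 := by nlinarith [norm_nonneg z]
  have h1 := h z hz1
  rw [lintegral_powMeasure] at h1
  simp only [Real.rpow_zero, ENNReal.ofReal_one, one_mul] at h1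
  simp_rw [ENNReal.ofReal_mul (pow_nonneg hz2.le (n + 1))]
  rw [lintegral_const_mul' _ _ ENNReal.ofReal_ne_top]
  have h2 : ∀ w : Cn n, koranyi z w ^ (-(2 * ((n : ℝ) + 1)))
      = koranyi w z ^ (-((n : ℝ) + 1 + 0 + (n + 1))) := fun w => by
    rw [koranyi_comm]; congr 1; ring
  simp_rw [h2]
  refine (mul_le_mul_right h1 _).trans (le_of_eq ?_)
  rw [mul_left_comm, ← ENNReal.ofReal_mul (by positivity), Real.rpow_neg hz2.le]
  have : (1 - ‖z‖ ^ 2) ^ ((n : ℝ) + 1) = (1 - ‖z‖ ^ 2) ^ (n + 1) := by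
    exact_mod_cast Real.rpow_natCast _ (n + 1)
  rw [this, mul_inv_cancel₀ (by positivity)]
  simp

/-- Tonelli moves the kernel onto the weight, where the factor `(1-|z|²)^(n+1)` raises the exponent
to `t + n + 1`. The two-point estimate with `b = 2(n+1)` then returns the weight at `w`; its
condition on `b` is precisely `t < 0`. -/
theorem moebiusIntegral_berezin_le (hn : 1 ≤ n) {t c : ℝ} (hc : 0 ≤ c)
    (ht0 : -1 < t + (n + 1)) (ht : t < 0) (hct : 2 * c < n + 1 + (t + (n + 1))) :
    ∃ C : ℝ≥0∞, C ≠ ⊤ ∧ ∀ g : Cn n → ℝ≥0∞, Measurable g → ∀ a ∈ unitBall n,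
      moebiusIntegral t c (fun z => ∫⁻ w in unitBall n, g w * ENNReal.ofReal
        ((1 - ‖z‖ ^ 2) ^ (n + 1) * koranyi z w ^ (-(2 * ((n : ℝ) + 1))))) a
      ≤ C * moebiusIntegral t c g a := by
  obtain ⟨C, hC, h⟩ := lintegral_koranyi_mul_koranyi_le hn (t := t + (n + 1)) (c := 2 * c)
    (b := 2 * ((n : ℝ) + 1)) ht0 (by linarith) hct (by linarith)
  refine ⟨C, hC, fun g hg a ha => ?_⟩
  have ha1 := mem_ball_zero_iff.1 ha
  have ha2 : 0 < 1 - ‖a‖ ^ 2 := by nlinarith [norm_nonneg a]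
  have hk := (continuous_koranyi (n := n)).measurable
  have hka := (continuous_koranyi_left a).measurable
  set K : Cn n → Cn n → ℝ≥0∞ := fun z w => ENNReal.ofReal ((1 - ‖z‖ ^ 2) ^ (n + 1) *
    koranyi z w ^ (-(2 * ((n : ℝ) + 1)))) with hK
  have hKm : Measurable fun x : Cn n × Cn n => K x.1 x.2 := by fun_prop
  set V : Cn n → ℝ≥0∞ := fun z =>
    ENNReal.ofReal ((1 - ‖a‖ ^ 2) ^ c * koranyi z a ^ (-(2 * c))) with hV
  have hVm : Measurable V := by fun_prop
  have hVt : ∀ z, V z ≠ ⊤ := fun z => ENNReal.ofReal_ne_top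
  have hinner : ∀ w ∈ unitBall n, ∫⁻ z in unitBall n,
      ENNReal.ofReal ((1 - ‖z‖ ^ 2) ^ t) * (K z w * V z)
        ≤ C * (ENNReal.ofReal ((1 - ‖w‖ ^ 2) ^ t) * V w) := by
    intro w hw
    have h1 := h w a (mem_ball_zero_iff.1 hw) ha1
    have hw2 : 0 < 1 - ‖w‖ ^ 2 := by nlinarith [norm_nonneg w, mem_ball_zero_iff.1 hw]
    rw [lintegral_powMeasure] at h1
    calc _ = ENNReal.ofReal ((1 - ‖a‖ ^ 2) ^ c) * ∫⁻ z in unitBall n,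
            ENNReal.ofReal ((1 - ‖z‖ ^ 2) ^ (t + (n + 1))) * ENNReal.ofReal
              (koranyi z w ^ (-(2 * ((n : ℝ) + 1))) * koranyi z a ^ (-(2 * c))) := by
          rw [← lintegral_const_mul' _ _ ENNReal.ofReal_ne_top]
          refine setLIntegral_congr_fun Metric.isOpen_ball.measurableSet fun z hz => ?_
          have hz2 : 0 < 1 - ‖z‖ ^ 2 := by nlinarith [norm_nonneg z, mem_ball_zero_iff.1 hz]
          have hk0 := koranyi_nonneg z w
          have hk1 := koranyi_nonneg z a
          simp only [hK, hV]
          rw [← ENNReal.ofReal_mul (by positivity), ← ENNReal.ofReal_mul (by positivity),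
            ← ENNReal.ofReal_mul (by positivity), ← ENNReal.ofReal_mul (by positivity),
            Real.rpow_add hz2]
          have : (1 - ‖z‖ ^ 2) ^ ((n : ℝ) + 1) = (1 - ‖z‖ ^ 2) ^ (n + 1) := by
            exact_mod_cast Real.rpow_natCast _ (n + 1)
          rw [this]; congr 1; ring
      _ ≤ _ := mul_le_mul_right h1 _
      _ = _ := by
          have hk1 := koranyi_nonneg w a
          simp only [hV]
          rw [mul_left_comm, ← ENNReal.ofReal_mul (by positivity),
            ← ENNReal.ofReal_mul (by positivity)]
          rw [show -(2 * ((n : ℝ) + 1) - (n + 1 + (t + (n + 1)))) = t by ring]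
          congr 2; ring
  have hm1 : Measurable fun x : Cn n × Cn n =>
      ENNReal.ofReal ((1 - ‖x.1‖ ^ 2) ^ t) * (g x.2 * K x.1 x.2 * V x.1) := by fun_prop
  calc moebiusIntegral t c (fun z => ∫⁻ w in unitBall n, g w * K z w) a
      = ∫⁻ z in unitBall n, ∫⁻ w in unitBall n,
          ENNReal.ofReal ((1 - ‖z‖ ^ 2) ^ t) * (g w * K z w * V z) := by
        rw [moebiusIntegral, lintegral_powMeasure]
        refine lintegral_congr fun z => ?_
        rw [lintegral_const_mul' _ _ ENNReal.ofReal_ne_top, lintegral_mul_const' _ _ (hVt z)]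
    _ = ∫⁻ w in unitBall n, ∫⁻ z in unitBall n,
          ENNReal.ofReal ((1 - ‖z‖ ^ 2) ^ t) * (g w * K z w * V z) :=
        lintegral_lintegral_swap (by exact hm1.aemeasurable)
    _ ≤ ∫⁻ w in unitBall n, g w * (C * (ENNReal.ofReal ((1 - ‖w‖ ^ 2) ^ t) * V w)) := by
        refine setLIntegral_mono' Metric.isOpen_ball.measurableSet fun w hw => ?_
        refine le_trans (le_of_eq ?_) (mul_le_mul_right (hinner w hw) (g w))
        rw [← lintegral_const_mul _ (by fun_prop)]
        refine lintegral_congr fun z => ?_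
        ring
    _ = _ := by
        rw [moebiusIntegral, lintegral_powMeasure, ← lintegral_const_mul' _ _ hC]
        refine lintegral_congr fun z => ?_
        simp only [hV]; ring

theorem enorm_sub_rpow_le {p : ℝ} (hp : 1 ≤ p) (x y : ℂ) :
    ‖x - y‖ₑ ^ p ≤ 2 ^ (p - 1) * (‖x‖ₑ ^ p + ‖y‖ₑ ^ p) :=
  (ENNReal.rpow_le_rpow (enorm_sub_le) (by linarith)).trans
    (ENNReal.rpow_add_le_mul_rpow_add_rpow _ _ hp)

theorem moebiusIntegral_oscIntegral_le (hn : 1 ≤ n) {p t c : ℝ} (hp : 1 ≤ p) (hc : 0 ≤ c)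
    (ht0 : -1 < t + (n + 1)) (ht : t < 0) (hct : 2 * c < n + 1 + (t + (n + 1))) :
    ∃ C : ℝ≥0∞, C ≠ ⊤ ∧ ∀ f : Cn n → ℂ, Measurable f → ∀ a ∈ unitBall n,
      moebiusIntegral t c (oscIntegral p f) a
        ≤ C * moebiusIntegral t c (fun z => ‖f z‖ₑ ^ p) a := by
  obtain ⟨C₁, hC₁, h₁⟩ := lintegral_berezin_kernel_le hn
  obtain ⟨C₂, hC₂, h₂⟩ := moebiusIntegral_berezin_le hn hc ht0 ht hct
  have h2p : (2 : ℝ≥0∞) ^ (p - 1) ≠ ⊤ := ENNReal.rpow_ne_top_of_nonneg (by linarith) (by simp)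
  refine ⟨2 ^ (p - 1) * (C₁ + C₂), by finiteness, fun f hf a ha => ?_⟩
  have hfm : Measurable fun z => ‖f z‖ₑ ^ p := by fun_prop
  have hk := (continuous_koranyi (n := n)).measurable
  set K : Cn n → Cn n → ℝ≥0∞ := fun z w => ENNReal.ofReal ((1 - ‖z‖ ^ 2) ^ (n + 1) *
    koranyi z w ^ (-(2 * ((n : ℝ) + 1)))) with hK
  have hKm : Measurable fun x : Cn n × Cn n => K x.1 x.2 := by fun_prop
  calc _ ≤ moebiusIntegral t c (fun z => 2 ^ (p - 1) *
          (C₁ * ‖f z‖ₑ ^ p + ∫⁻ w in unitBall n, ‖f w‖ₑ ^ p * K z w)) a := by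
        refine moebiusIntegral_mono _ _ (fun z hz => ?_) a
        calc oscIntegral p f z
            ≤ ∫⁻ w in unitBall n, 2 ^ (p - 1) * (‖f z‖ₑ ^ p * K z w + ‖f w‖ₑ ^ p * K z w) := by
              refine lintegral_mono fun w => ?_
              rw [← add_mul, ← mul_assoc]
              exact mul_le_mul_left (enorm_sub_rpow_le hp _ _) _
          _ = 2 ^ (p - 1) * (‖f z‖ₑ ^ p * (∫⁻ w in unitBall n, K z w)
                + ∫⁻ w in unitBall n, ‖f w‖ₑ ^ p * K z w) := by
              rw [lintegral_const_mul' _ _ h2p, lintegral_add_left (by fun_prop),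
                lintegral_const_mul _ (by fun_prop)]
          _ ≤ _ := by
              rw [mul_comm C₁]
              gcongr
              exact h₁ z hz
    _ = 2 ^ (p - 1) * (C₁ * moebiusIntegral t c (fun z => ‖f z‖ₑ ^ p) a
          + moebiusIntegral t c (fun z => ∫⁻ w in unitBall n, ‖f w‖ₑ ^ p * K z w) a) := by
        rw [moebiusIntegral_const_mul _ _ h2p, ← moebiusIntegral_const_mul _ _ hC₁]
        congr 1
        simp only [moebiusIntegral, add_mul]
        have hka := (continuous_koranyi_left a).measurable
        exact lintegral_add_left (by fun_prop) _
    _ ≤ 2 ^ (p - 1) * (C₁ * moebiusIntegral t c (fun z => ‖f z‖ₑ ^ p) a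
          + C₂ * moebiusIntegral t c (fun z => ‖f z‖ₑ ^ p) a) := by
        gcongr
        exact h₂ _ hfm a ha
    _ = _ := by ring

end OscillationBound

/-! ### The sub-mean value property of `|h|^p`. -/

section SubMean

variable {n : ℕ}

theorem lintegral_rpow_le_measure_univ_mul {α : Type*} [MeasurableSpace α] {μ : Measure α} {p : ℝ}
    (hp : 1 ≤ p) {φ : α → ℝ≥0∞} (hφ : AEMeasurable φ μ) :
    (∫⁻ x, φ x ∂μ) ^ p ≤ μ Set.univ ^ (p - 1) * ∫⁻ x, φ x ^ p ∂μ := by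
  have hp0 : 0 < p := by linarith
  have h := eLpNorm_le_eLpNorm_mul_rpow_measure_univ (μ := μ) (f := φ) (p := 1)
    (q := ENNReal.ofReal p) (by rw [← ENNReal.ofReal_one]; exact ENNReal.ofReal_le_ofReal hp)
    hφ.aestronglyMeasurable
  rw [eLpNorm_one_eq_lintegral_enorm, eLpNorm_eq_lintegral_rpow_enorm_toReal (by simpa using hp0)
    ENNReal.ofReal_ne_top, ENNReal.toReal_ofReal hp0.le] at h
  simp only [enorm_eq_self, ENNReal.toReal_one] at h
  have h2 := ENNReal.rpow_le_rpow h hp0.le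
  rw [ENNReal.mul_rpow_of_nonneg _ _ hp0.le, ← ENNReal.rpow_mul, ← ENNReal.rpow_mul,
    one_div_mul_cancel hp0.ne', ENNReal.rpow_one] at h2
  rw [mul_comm]
  convert h2 using 3
  field_simp

theorem lintegral_ball_unit_smul {c : ℂ} (hc : ‖c‖ = 1) (F : Cn n → ℝ≥0∞) :
    ∫⁻ u in unitBall n, F (c • u) = ∫⁻ u in unitBall n, F u := by
  have hc0 : c ≠ 0 := by rintro rfl; simp at hc
  let e : Cn n ≃ₗᵢ[ℝ] Cn n :=
    ⟨(LinearEquiv.smulOfNeZero ℂ (Cn n) c hc0).restrictScalars ℝ, fun x => by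
      simp [norm_smul, hc]⟩
  have h := e.measurePreserving.setLIntegral_comp_preimage_emb
    e.toHomeomorph.measurableEmbedding F (unitBall n)
  have hpre : e ⁻¹' unitBall n = unitBall n := by
    ext u; simp
  rw [hpre] at h
  exact h

theorem enorm_rpow_le_circle_lintegral {p : ℝ} (hp : 1 ≤ p) {φ : ℂ → ℂ} (hm : Measurable φ)
    (hφ : DiffContOnCl ℂ φ (Metric.ball 0 1)) :
    ENNReal.ofReal (2 * Real.pi) * ‖φ 0‖ₑ ^ p
      ≤ ∫⁻ θ in Set.Ioc 0 (2 * Real.pi), ‖φ (circleMap 0 1 θ)‖ₑ ^ p := by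
  have h2π : 0 < 2 * Real.pi := by positivity
  have h1 := DiffContOnCl.circleAverage (R := 1) (c := (0 : ℂ)) (f := φ) (by simpa using hφ)
  rw [Real.circleAverage, intervalIntegral.integral_of_le h2π.le] at h1
  have h2 : φ 0 * (2 * Real.pi : ℝ) = ∫ θ in Set.Ioc 0 (2 * Real.pi), φ (circleMap 0 1 θ) := by
    rw [← h1, Complex.real_smul]; push_cast; field_simp
  have h3 : ‖φ 0‖ₑ * ENNReal.ofReal (2 * Real.pi)
      ≤ ∫⁻ θ in Set.Ioc 0 (2 * Real.pi), ‖φ (circleMap 0 1 θ)‖ₑ := by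
    rw [← Real.enorm_of_nonneg h2π.le]
    calc ‖φ 0‖ₑ * ‖2 * Real.pi‖ₑ = ‖φ 0 * (2 * Real.pi : ℝ)‖ₑ := by
          rw [enorm_mul]; simp [enorm_eq_nnnorm]
      _ ≤ _ := by rw [h2]; exact enorm_integral_le_lintegral_enorm _
  have hmeas : Measurable fun θ : ℝ => ‖φ (circleMap 0 1 θ)‖ₑ :=
    (hm.comp (continuous_circleMap 0 1).measurable).enorm
  have h4 := lintegral_rpow_le_measure_univ_mul hp
    (μ := volume.restrict (Set.Ioc 0 (2 * Real.pi))) hmeas.aemeasurable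
  rw [Measure.restrict_apply_univ, Real.volume_Ioc, sub_zero] at h4
  have h5 := (ENNReal.rpow_le_rpow h3 (by linarith : 0 ≤ p)).trans h4
  set A := ENNReal.ofReal (2 * Real.pi) with hA
  have hA0 : A ≠ 0 := by rw [hA]; simpa using h2π
  have hAt : A ≠ ⊤ := ENNReal.ofReal_ne_top
  rw [ENNReal.mul_rpow_of_nonneg _ _ (by linarith : 0 ≤ p)] at h5
  have h6 : A ^ p = A ^ (p - 1) * A := by
    conv_lhs => rw [show p = (p - 1) + 1 by ring]
    rw [ENNReal.rpow_add _ _ hA0 hAt, ENNReal.rpow_one]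
  rw [h6, mul_comm, mul_assoc] at h5
  exact (ENNReal.mul_le_mul_iff_right (ENNReal.rpow_pos hA0.bot_lt hAt).ne'
    (ENNReal.rpow_ne_top_of_nonneg (by linarith) hAt)).1 h5

/-- Apply the one-variable circle inequality to `l ↦ h(l u)` for each `u`, integrate over the ball,
and use that multiplication by a unimodular scalar preserves volume. -/
theorem enorm_rpow_mul_volume_le {p : ℝ} (hp : 1 ≤ p) {h : Cn n → ℂ} (hm : Measurable h)
    (hh : DifferentiableOn ℂ h (unitBall n)) :
    ‖h 0‖ₑ ^ p * volume (unitBall n) ≤ ∫⁻ u in unitBall n, ‖h u‖ₑ ^ p := by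
  have h2π : 0 < 2 * Real.pi := by positivity
  set A := ENNReal.ofReal (2 * Real.pi) with hA
  have hA0 : A ≠ 0 := by rw [hA]; simpa using h2π
  have hAt : A ≠ ⊤ := ENNReal.ofReal_ne_top
  have hmeas : Measurable fun x : Cn n × ℝ => ‖h (circleMap 0 1 x.2 • x.1)‖ₑ ^ p := by
    have := (continuous_circleMap 0 1).measurable
    fun_prop
  have hpt : ∀ u ∈ unitBall n, A * ‖h 0‖ₑ ^ p
      ≤ ∫⁻ θ in Set.Ioc 0 (2 * Real.pi), ‖h (circleMap 0 1 θ • u)‖ₑ ^ p := by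
    intro u hu
    have hu1 := mem_ball_zero_iff.1 hu
    have := enorm_rpow_le_circle_lintegral hp (φ := fun l : ℂ => h (l • u)) (by fun_prop) ?_
    · simpa only [zero_smul] using this
    · refine DifferentiableOn.diffContOnCl ?_
      refine hh.comp (by fun_prop) fun l hl => ?_
      have : ‖l‖ ≤ 1 := by
        have := Metric.closure_ball_subset_closedBall hl
        simpa using this
      rw [mem_ball_zero_iff, norm_smul]
      nlinarith [norm_nonneg u]
  have key : A * (‖h 0‖ₑ ^ p * volume (unitBall n)) ≤ A * ∫⁻ u in unitBall n, ‖h u‖ₑ ^ p := by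
    calc A * (‖h 0‖ₑ ^ p * volume (unitBall n))
        = ∫⁻ u in unitBall n, A * ‖h 0‖ₑ ^ p := by rw [setLIntegral_const, mul_assoc]
      _ ≤ ∫⁻ u in unitBall n, ∫⁻ θ in Set.Ioc 0 (2 * Real.pi),
            ‖h (circleMap 0 1 θ • u)‖ₑ ^ p :=
          setLIntegral_mono' Metric.isOpen_ball.measurableSet hpt
      _ = ∫⁻ θ in Set.Ioc 0 (2 * Real.pi), ∫⁻ u in unitBall n,
            ‖h (circleMap 0 1 θ • u)‖ₑ ^ p := lintegral_lintegral_swap (by exact hmeas.aemeasurable)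
      _ = ∫⁻ θ in Set.Ioc 0 (2 * Real.pi), ∫⁻ u in unitBall n, ‖h u‖ₑ ^ p := by
          refine lintegral_congr fun θ => ?_
          exact lintegral_ball_unit_smul (by simp [circleMap, Complex.norm_exp_ofReal_mul_I])
            (fun u => ‖h u‖ₑ ^ p)
      _ = _ := by rw [setLIntegral_const, Real.volume_Ioc, sub_zero, mul_comm]
  exact (ENNReal.mul_le_mul_iff_right hA0 hAt).1 key

end SubMean

/-! ### Sub-mean values on nonisotropic neighbourhoods. -/

section BergmanBall

variable {n : ℕ}

/-- A nonisotropic neighbourhood of `w` in the unit ball, comparable to a Bergman ball. -/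
def bergmanNhd (w : Cn n) : Set (Cn n) :=
  {v | v ∈ unitBall n ∧ (1 - ‖w‖) / 5 ≤ 1 - ‖v‖ ∧ koranyi v w ≤ 3 * (1 - ‖w‖)}

theorem bergmanNhd_subset (w : Cn n) : bergmanNhd w ⊆ unitBall n := fun _ hv => hv.1

theorem measurableSet_bergmanNhd (w : Cn n) : MeasurableSet (bergmanNhd w) :=
  Metric.isOpen_ball.measurableSet.inter
    ((measurableSet_le measurable_const (measurable_const.sub measurable_norm)).inter
      (measurableSet_le (continuous_koranyi_left w).measurable measurable_const))

/-- With `y = 1 - |w|`, the dilation moves `w` by at most `y/16` along `e`, and its transversal part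
adds at most `y/16` to the squared norm. The point therefore stays at distance at least `y/5` from
the sphere. -/
theorem add_anisoScale_mem_bergmanNhd {e w u : Cn n} (he : ‖e‖ = 1) (hwe : w = (‖w‖ : ℂ) • e)
    (hw : ‖w‖ < 1) (hu : ‖u‖ < 1) :
    w + anisoScale e (Real.sqrt (1 - ‖w‖) / 4) u ∈ bergmanNhd w := by
  set y := 1 - ‖w‖ with hy
  set r := Real.sqrt y / 4 with hr
  have hy0 : 0 < y := by linarith
  have hw0 := norm_nonneg w
  have hr2 : r ^ 2 = y / 16 := by rw [hr, div_pow, Real.sq_sqrt hy0.le]; norm_num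
  have hr0 : 0 ≤ r := by positivity
  set α := pairing u e with hα
  have h11 : pairing e e = 1 := by rw [pairing_self, he]; simp
  set v := w + anisoScale e r u with hv
  have hαn : ‖α‖ ≤ 1 := by
    have := norm_pairing_le u e
    rw [he, mul_one] at this; linarith
  have hve : pairing v e = ‖w‖ + (r : ℂ) ^ 2 * α := by
    rw [hv, anisoScale_apply, pairing_add_left, pairing_smul_left, pairing_sub_left,
      pairing_smul_left, h11, ← hα]
    nth_rw 1 [hwe]
    rw [pairing_smul_left, h11]
    push_cast; ring
  have hrest : v - pairing v e • e = (r : ℂ) • (u - α • e) := by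
    rw [hve, hv, anisoScale_apply, ← hα]
    nth_rw 1 [hwe]
    push_cast
    module
  have hnorm : ‖v‖ ^ 2 = ‖pairing v e‖ ^ 2 + r ^ 2 * (‖u‖ ^ 2 - ‖α‖ ^ 2) := by
    have h := norm_sub_pairing_smul_sq he v
    rw [hrest, norm_smul, mul_pow, norm_sub_pairing_smul_sq he u, Complex.norm_real,
      Real.norm_of_nonneg hr0] at h
    linarith
  have hb1 : ‖pairing v e‖ ≤ ‖w‖ + y / 16 := by
    rw [hve]
    refine (norm_add_le _ _).trans ?_
    rw [norm_mul, norm_pow, Complex.norm_real, Complex.norm_real, norm_norm,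
      Real.norm_of_nonneg hr0, hr2]
    nlinarith
  have hv2 : ‖v‖ ^ 2 ≤ 1 - 2 * (y / 5) := by
    rw [hnorm, hr2]
    have e1 : ‖pairing v e‖ ^ 2 ≤ (‖w‖ + y / 16) ^ 2 := by gcongr
    have e2 : y / 16 * (‖u‖ ^ 2 - ‖α‖ ^ 2) ≤ y / 16 := by
      have : ‖u‖ ^ 2 ≤ 1 := by nlinarith [norm_nonneg u]
      have : ‖u‖ ^ 2 - ‖α‖ ^ 2 ≤ 1 := by nlinarith [norm_nonneg α]
      nlinarith
    have e3 : ‖w‖ = 1 - y := by rw [hy]; ring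
    rw [e3] at e1 hw0
    nlinarith
  have hv1 : y / 5 ≤ 1 - ‖v‖ := by nlinarith [norm_nonneg v, sq_nonneg (1 - ‖v‖)]
  refine ⟨mem_ball_zero_iff.2 (by linarith), hv1, ?_⟩
  have hvw : pairing v w = ‖w‖ * pairing v e := by
    conv_lhs => rw [hwe]
    rw [pairing_smul_right]; simp
  have : 1 - pairing v w = ((1 - ‖w‖ ^ 2 : ℝ) : ℂ) - (‖w‖ : ℂ) * ((r : ℂ) ^ 2 * α) := by
    rw [hvw, hve]; push_cast; ring
  rw [koranyi, this]
  refine (norm_sub_le _ _).trans ?_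
  rw [norm_mul, norm_mul, norm_pow, Complex.norm_real, Complex.norm_real, Complex.norm_real,
    norm_norm, Real.norm_of_nonneg hr0, hr2, Real.norm_of_nonneg (by nlinarith)]
  have e3 : ‖w‖ = 1 - y := by rw [hy]; ring
  have e4 : ‖w‖ * (y / 16 * ‖α‖) ≤ y / 16 := by
    have : y / 16 * ‖α‖ ≤ y / 16 := by nlinarith
    have : 0 ≤ y / 16 * ‖α‖ := by positivity
    nlinarith
  rw [e3] at e4 hw0 ⊢
  nlinarith

theorem lintegral_add_anisoScale_le {e w : Cn n} (he : ‖e‖ = 1) (hwe : w = (‖w‖ : ℂ) • e)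
    (hw : ‖w‖ < 1) {F : Cn n → ℝ≥0∞} (hF : Measurable F) :
    ∫⁻ u in unitBall n, F (w + anisoScale e (Real.sqrt (1 - ‖w‖) / 4) u)
      ≤ ENNReal.ofReal (((1 - ‖w‖) / 16) ^ (n + 1))⁻¹ * ∫⁻ v in bergmanNhd w, F v := by
  have hy0 : 0 < 1 - ‖w‖ := by linarith
  have hr0 : 0 < Real.sqrt (1 - ‖w‖) / 4 := by have := Real.sqrt_pos.2 hy0; positivity
  have hr2 : (Real.sqrt (1 - ‖w‖) / 4) ^ 2 = (1 - ‖w‖) / 16 := by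
    rw [div_pow, Real.sq_sqrt hy0.le]; norm_num
  have hFm : Measurable ((bergmanNhd w).indicator F) := hF.indicator (measurableSet_bergmanNhd w)
  calc _ ≤ ∫⁻ u, (bergmanNhd w).indicator F (w + anisoScale e (Real.sqrt (1 - ‖w‖) / 4) u) := by
        rw [← lintegral_indicator Metric.isOpen_ball.measurableSet]
        refine lintegral_mono fun u => ?_
        by_cases hu : u ∈ unitBall n
        · rw [Set.indicator_of_mem hu, Set.indicator_of_mem
            (add_anisoScale_mem_bergmanNhd he hwe hw (mem_ball_zero_iff.1 hu))]
        · simp [hu]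
    _ = _ := by
        rw [lintegral_comp_anisoScale he hr0 (F := fun v => (bergmanNhd w).indicator F (w + v))
          (by fun_prop), hr2, lintegral_add_left_eq_self,
          lintegral_indicator (measurableSet_bergmanNhd w)]

theorem volume_bergmanNhd_ge (hn : 1 ≤ n) {w : Cn n} (hw : ‖w‖ < 1) :
    ENNReal.ofReal (((1 - ‖w‖) / 16) ^ (n + 1)) * volume (unitBall n)
      ≤ volume (bergmanNhd w) := by
  obtain ⟨e, he, hwe⟩ := exists_unit_direction hn w
  have hy0 : 0 < ((1 - ‖w‖) / 16) ^ (n + 1) := by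
    have : 0 < 1 - ‖w‖ := by linarith
    positivity
  have h := lintegral_add_anisoScale_le he hwe hw (F := fun _ => 1) measurable_const
  rw [setLIntegral_const, setLIntegral_const, one_mul, one_mul, ENNReal.ofReal_inv_of_pos hy0] at h
  refine (mul_le_mul_right h _).trans (le_of_eq ?_)
  rw [← mul_assoc, ENNReal.mul_inv_cancel (by simpa using hy0) ENNReal.ofReal_ne_top, one_mul]

/-- The sub-mean value property of the ball, transported by the complex affine map `u ↦ w +
anisoScale e r u`, which preserves holomorphy. Its Jacobian is the displayed factor. -/
theorem enorm_rpow_mul_volume_le_bergmanNhd (hn : 1 ≤ n) {p : ℝ} (hp : 1 ≤ p) {g : Cn n → ℂ}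
    (hm : Measurable g) (hg : DifferentiableOn ℂ g (unitBall n)) {w : Cn n} (hw : ‖w‖ < 1) :
    ‖g w‖ₑ ^ p * volume (unitBall n)
      ≤ ENNReal.ofReal (((1 - ‖w‖) / 16) ^ (n + 1))⁻¹ * ∫⁻ v in bergmanNhd w, ‖g v‖ₑ ^ p := by
  obtain ⟨e, he, hwe⟩ := exists_unit_direction hn w
  refine le_trans ?_ (lintegral_add_anisoScale_le he hwe hw (F := fun v => ‖g v‖ₑ ^ p)
    (by fun_prop))
  have hc := continuous_anisoScale e (Real.sqrt (1 - ‖w‖) / 4)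
  have hd : Differentiable ℂ (anisoScale e (Real.sqrt (1 - ‖w‖) / 4)) :=
    (LinearMap.toContinuousLinearMap (anisoScale e (Real.sqrt (1 - ‖w‖) / 4))).differentiable
  have := enorm_rpow_mul_volume_le hp
    (h := fun u => g (w + anisoScale e (Real.sqrt (1 - ‖w‖) / 4) u))
    (hm.comp (continuous_const.add hc).measurable)
    (hg.comp (by fun_prop) fun u hu =>
      (add_anisoScale_mem_bergmanNhd he hwe hw (mem_ball_zero_iff.1 hu)).1)
  simpa using this

end BergmanBall

/-! ### Pointwise differences controlled by the oscillation. -/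

section LocalOscillation

variable {n : ℕ}

theorem rpow_le_of_comparable {x y K : ℝ} (hy : 0 < y) (hK : 1 ≤ K) (h1 : y ≤ K * x)
    (h2 : x ≤ K * y) (t : ℝ) : x ^ t ≤ K ^ |t| * y ^ t := by
  have hK0 : 0 < K := by linarith
  have hx : 0 < x := by
    by_contra h
    nlinarith
  rcases le_total 0 t with ht | ht
  · rw [abs_of_nonneg ht, ← Real.mul_rpow hK0.le hy.le]
    exact Real.rpow_le_rpow hx.le h2 ht
  · rw [abs_of_nonpos ht, Real.rpow_neg hK0.le, ← Real.inv_rpow hK0.le,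
      ← Real.mul_rpow (by positivity) hy.le]
    refine Real.rpow_le_rpow_of_nonpos (by positivity) ?_ ht
    rw [inv_mul_le_iff₀ hK0]; exact h1

/-- Use the sub-mean value property of `v ↦ f z - f v` around `w`. There `|1-⟨z,v⟩| ≤ 16 M (1-|z|)`,
so the averaging density is dominated by a multiple of the Berezin kernel at `z`. -/
theorem enorm_sub_rpow_le_oscIntegral (hn : 1 ≤ n) {p M : ℝ} (hp : 1 ≤ p) (hM : 1 ≤ M) :
    ∃ C : ℝ≥0∞, C ≠ ⊤ ∧ ∀ f : Cn n → ℂ, Measurable f → DifferentiableOn ℂ f (unitBall n) →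
      ∀ z w : Cn n, ‖z‖ < 1 → ‖w‖ < 1 → 1 - ‖z‖ ≤ M * (1 - ‖w‖) → koranyi z w ≤ M * (1 - ‖z‖) →
        ‖f z - f w‖ₑ ^ p ≤ C * oscIntegral p f z := by
  refine ⟨(volume (unitBall n))⁻¹ *
    ENNReal.ofReal ((16 * M) ^ (n + 1) * (16 * M) ^ (2 * ((n : ℝ) + 1))),
    ENNReal.mul_ne_top volume_unitBall_inv_ne_top ENNReal.ofReal_ne_top,
    fun f hm hf z w hz hw hzw hk => ?_⟩
  have hM0 : 0 < M := by linarith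
  have hy0 : 0 < 1 - ‖w‖ := by linarith
  have hz0 : 0 < 1 - ‖z‖ := by linarith
  have h1 := enorm_rpow_mul_volume_le_bergmanNhd hn hp (g := fun v => f z - f v) (by fun_prop)
    (hf.const_sub (f z)) hw
  have hV0 := (Metric.measure_ball_pos (volume : Measure (Cn n)) 0 one_pos).ne'
  have hVt : volume (unitBall n) ≠ ⊤ := measure_ball_lt_top.ne
  rw [mul_comm, ENNReal.mul_le_iff_le_inv hV0 hVt] at h1
  refine h1.trans ?_
  rw [mul_assoc]
  refine mul_le_mul_right ?_ _
  rw [← lintegral_const_mul' _ _ ENNReal.ofReal_ne_top, oscIntegral,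
    ← lintegral_const_mul' _ _ ENNReal.ofReal_ne_top]
  refine (setLIntegral_mono' (measurableSet_bergmanNhd w) fun v hv => ?_).trans
    (lintegral_mono_set (bergmanNhd_subset w))
  rw [mul_left_comm _ (‖f z - f v‖ₑ ^ p), mul_comm]
  refine mul_le_mul_right ?_ _
  rw [← ENNReal.ofReal_mul (by positivity)]
  refine ENNReal.ofReal_le_ofReal ?_
  obtain ⟨hvB, hv1, hv2⟩ := hv
  have hvB1 := mem_ball_zero_iff.1 hvB
  have hkp : 0 < koranyi z v := koranyi_pos hz hvB1.le
  have hz2 : 1 - ‖z‖ ≤ 1 - ‖z‖ ^ 2 := by nlinarith [norm_nonneg z]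
  have hkv : koranyi z v ≤ 16 * M * (1 - ‖z‖) := by
    have e1 := koranyi_quasi_triangle hn hz hvB1 hw.le
    have e2 := one_sub_norm_right_le_koranyi (w := w) hz.le
    rw [koranyi_comm w v] at e1
    linarith
  have e3 : (koranyi z v) ^ (-(2 * ((n : ℝ) + 1)))
      ≥ (16 * M * (1 - ‖z‖)) ^ (-(2 * ((n : ℝ) + 1))) :=
    Real.rpow_le_rpow_of_nonpos hkp hkv (by have : (0 : ℝ) ≤ n := Nat.cast_nonneg n; linarith)
  have e4 : (((1 - ‖w‖) / 16) ^ (n + 1))⁻¹ ≤ (16 * M) ^ (n + 1) * ((1 - ‖z‖) ^ (n + 1))⁻¹ := by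
    rw [← inv_pow, ← inv_pow, ← mul_pow]
    refine pow_le_pow_left₀ (by positivity) ?_ _
    rw [inv_div, ← div_eq_mul_inv, div_le_div_iff₀ hy0 hz0]
    nlinarith
  calc _ ≤ (16 * M) ^ (n + 1) * ((1 - ‖z‖) ^ (n + 1))⁻¹ := e4
    _ = (16 * M) ^ (n + 1) * (16 * M) ^ (2 * ((n : ℝ) + 1)) * ((1 - ‖z‖) ^ (n + 1) *
          (16 * M * (1 - ‖z‖)) ^ (-(2 * ((n : ℝ) + 1)))) := by
        have e5 : (1 - ‖z‖) ^ (2 * ((n : ℝ) + 1)) = (1 - ‖z‖) ^ (n + 1) * (1 - ‖z‖) ^ (n + 1) := by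
          rw [← pow_add, ← Real.rpow_natCast]; push_cast; congr 1; ring
        rw [Real.rpow_neg (by positivity), Real.mul_rpow (by positivity) hz0.le, e5]
        field_simp
    _ ≤ _ := by
        have : 0 ≤ 1 - ‖z‖ ^ 2 := hz0.le.trans hz2
        gcongr

/-- Finiteness of the Möbius integrals of the oscillation controls differences of the function at
points within bounded Bergman distance. -/
theorem enorm_sub_rpow_le_of_moebiusIntegral_le (hn : 1 ≤ n) {p M t c : ℝ} (hp : 1 ≤ p) (hM : 1 ≤ M)
    (hc : 0 ≤ c) :
    ∃ C : ℝ≥0∞, C ≠ ⊤ ∧ ∀ f : Cn n → ℂ, Measurable f → DifferentiableOn ℂ f (unitBall n) →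
      ∀ J : ℝ≥0∞, (∀ a ∈ unitBall n, moebiusIntegral t c (oscIntegral p f) a ≤ J) →
      ∀ z w : Cn n, ‖z‖ < 1 → ‖w‖ < 1 → 1 - ‖z‖ ≤ M * (1 - ‖w‖) → koranyi z w ≤ M * (1 - ‖z‖) →
        ‖f z - f w‖ₑ ^ p ≤ C * J * ENNReal.ofReal ((1 - ‖z‖) ^ (-(t + n + 1 - c))) := by
  -- For `v` near `z`, the quasi-triangle inequality gives `|1-⟨v,w⟩| ≤ 4(3+M)(1-|z|)`, and `1-|z| ≤
  -- 5(1-|v|)`; hence `20(3+M)`.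
  obtain ⟨C, hC, hCosc⟩ := enorm_sub_rpow_le_oscIntegral hn hp
    (M := 20 * (3 + M)) (by linarith)
  have h2p : (2 : ℝ≥0∞) ^ (p - 1) ≠ ⊤ := ENNReal.rpow_ne_top_of_nonneg (by linarith) (by simp)
  set B : ℝ := (6 : ℝ) ^ |t| * 3 ^ (2 * c) * 16 ^ (n + 1) with hB
  have hB0 : 0 < B := by positivity
  refine ⟨(volume (unitBall n))⁻¹ * ENNReal.ofReal B * (2 ^ (p - 1) * (C + C)),
    ENNReal.mul_ne_top (ENNReal.mul_ne_top volume_unitBall_inv_ne_top ENNReal.ofReal_ne_top)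
      (by finiteness), fun f hm hf J hJ z w hz hw hzw hk => ?_⟩
  set y := 1 - ‖z‖ with hy
  have hy0 : 0 < y := by linarith
  -- The hypothesis bounds the oscillation only on average, so the difference is bounded by the
  -- oscillation at every `v` near `z`, through `f v`, and then integrated in `v`. Only the
  -- parameter `a = z` is needed: near `z` the weight is at least a multiple of `y^(t-c)` and the
  -- volume at least one of `y^(n+1)`.
  have hosc : ∀ v ∈ bergmanNhd z, ‖f z - f w‖ₑ ^ p ≤ 2 ^ (p - 1) * (C + C) * oscIntegral p f v := by
    rintro v ⟨hvB, hv1, hv2⟩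
    have hvB1 := mem_ball_zero_iff.1 hvB
    have e1 : 1 - ‖v‖ ≤ 3 * y := (one_sub_norm_left_le_koranyi hz.le).trans hv2
    have e2 := koranyi_quasi_triangle hn hvB1 hw hz.le
    have o1 := hCosc f hm hf v z hvB1 hz (by nlinarith) (by nlinarith)
    have o2 := hCosc f hm hf v w hvB1 hw (by nlinarith) (by nlinarith)
    calc ‖f z - f w‖ₑ ^ p = ‖(f v - f w) - (f v - f z)‖ₑ ^ p := by congr 2; ring
      _ ≤ 2 ^ (p - 1) * (‖f v - f w‖ₑ ^ p + ‖f v - f z‖ₑ ^ p) := enorm_sub_rpow_le hp _ _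
      _ ≤ 2 ^ (p - 1) * (C * oscIntegral p f v + C * oscIntegral p f v) := by gcongr
      _ = _ := by ring
  have hker : ∀ v ∈ bergmanNhd z, (6 : ℝ) ^ (-|t|) * 3 ^ (-(2 * c)) * y ^ (t - c) ≤
      (1 - ‖v‖ ^ 2) ^ t * ((1 - ‖z‖ ^ 2) ^ c * koranyi v z ^ (-(2 * c))) := by
    rintro v ⟨hvB, hv1, hv2⟩
    have hvB1 := mem_ball_zero_iff.1 hvB
    have e1 : 1 - ‖v‖ ≤ 3 * y := (one_sub_norm_left_le_koranyi hz.le).trans hv2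
    have hkp : 0 < koranyi v z := koranyi_pos hvB1 hz.le
    have hx0 : 0 < 1 - ‖v‖ ^ 2 := by nlinarith [norm_nonneg v]
    have f1 : (6 : ℝ) ^ (-|t|) * y ^ t ≤ (1 - ‖v‖ ^ 2) ^ t := by
      have := rpow_le_of_comparable (x := y) (y := 1 - ‖v‖ ^ 2) (K := 6) hx0 (by norm_num)
        (by nlinarith [norm_nonneg v]) (by nlinarith [norm_nonneg v]) t
      rw [Real.rpow_neg (by norm_num), inv_mul_le_iff₀ (by positivity)]
      exact this
    have f2 : y ^ c ≤ (1 - ‖z‖ ^ 2) ^ c :=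
      Real.rpow_le_rpow hy0.le (by nlinarith [norm_nonneg z]) hc
    have f3 : 3 ^ (-(2 * c)) * y ^ (-(2 * c)) ≤ koranyi v z ^ (-(2 * c)) := by
      rw [← Real.mul_rpow (by norm_num) hy0.le]
      exact Real.rpow_le_rpow_of_nonpos hkp hv2 (by linarith)
    calc _ = ((6 : ℝ) ^ (-|t|) * y ^ t) * (y ^ c * (3 ^ (-(2 * c)) * y ^ (-(2 * c)))) := by
          have : y ^ (t - c) = y ^ t * y ^ c * y ^ (-(2 * c)) := by
            rw [← Real.rpow_add hy0, ← Real.rpow_add hy0]; congr 1; ring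
          rw [this]; ring
      _ ≤ _ := by
          have : 0 ≤ 1 - ‖z‖ ^ 2 := by nlinarith [norm_nonneg z]
          gcongr
  have hA0 : 0 < (6 : ℝ) ^ (-|t|) * 3 ^ (-(2 * c)) * y ^ (t - c) := by positivity
  set A : ℝ≥0∞ := ENNReal.ofReal ((6 : ℝ) ^ (-|t|) * 3 ^ (-(2 * c)) * y ^ (t - c)) with hA
  have hmain : ‖f z - f w‖ₑ ^ p * A * volume (bergmanNhd z) ≤ 2 ^ (p - 1) * (C + C) * J := by
    calc ‖f z - f w‖ₑ ^ p * A * volume (bergmanNhd z)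
        = ∫⁻ v in bergmanNhd z, ‖f z - f w‖ₑ ^ p * A := (setLIntegral_const _ _).symm
      _ ≤ ∫⁻ v in bergmanNhd z, 2 ^ (p - 1) * (C + C) * (ENNReal.ofReal ((1 - ‖v‖ ^ 2) ^ t) *
            (oscIntegral p f v * ENNReal.ofReal ((1 - ‖z‖ ^ 2) ^ c * koranyi v z ^ (-(2 * c))))) := by
          refine setLIntegral_mono' (measurableSet_bergmanNhd z) fun v hv => ?_
          have hx0 : 0 ≤ 1 - ‖v‖ ^ 2 := by
            nlinarith [norm_nonneg v, mem_ball_zero_iff.1 hv.1]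
          calc _ ≤ 2 ^ (p - 1) * (C + C) * oscIntegral p f v * ENNReal.ofReal ((1 - ‖v‖ ^ 2) ^ t *
                ((1 - ‖z‖ ^ 2) ^ c * koranyi v z ^ (-(2 * c)))) :=
                mul_le_mul' (hosc v hv) (ENNReal.ofReal_le_ofReal (hker v hv))
            _ = _ := by rw [ENNReal.ofReal_mul (by positivity)]; ring
      _ = 2 ^ (p - 1) * (C + C) * ∫⁻ v in bergmanNhd z, (ENNReal.ofReal ((1 - ‖v‖ ^ 2) ^ t) *
            (oscIntegral p f v * ENNReal.ofReal ((1 - ‖z‖ ^ 2) ^ c * koranyi v z ^ (-(2 * c))))) :=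
          lintegral_const_mul' _ _ (by finiteness)
      _ ≤ 2 ^ (p - 1) * (C + C) * moebiusIntegral t c (oscIntegral p f) z := by
          rw [moebiusIntegral, lintegral_powMeasure]
          exact mul_le_mul_right (lintegral_mono_set (bergmanNhd_subset z)) _
      _ ≤ _ := mul_le_mul_right (hJ z (mem_ball_zero_iff.2 hz)) _
  have hV0 := (Metric.measure_ball_pos (volume : Measure (Cn n)) 0 one_pos).ne'
  have hVt : volume (unitBall n) ≠ ⊤ := measure_ball_lt_top.ne
  have h3 : ‖f z - f w‖ₑ ^ p * (ENNReal.ofReal ((6 : ℝ) ^ (-|t|) * 3 ^ (-(2 * c)) * y ^ (t - c) *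
      (y / 16) ^ (n + 1)) * volume (unitBall n)) ≤ 2 ^ (p - 1) * (C + C) * J := by
    refine le_trans (le_of_eq ?_)
      ((mul_le_mul_right (volume_bergmanNhd_ge hn hz) (‖f z - f w‖ₑ ^ p * A)).trans hmain)
    rw [ENNReal.ofReal_mul hA0.le]
    ring
  have h4 : (6 : ℝ) ^ (-|t|) * 3 ^ (-(2 * c)) * y ^ (t - c) * (y / 16) ^ (n + 1)
      = (B * y ^ (-(t + n + 1 - c)))⁻¹ := by
    have : y ^ (-(t + n + 1 - c)) = (y ^ (t - c) * y ^ (n + 1))⁻¹ := by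
      rw [Real.rpow_neg hy0.le, show t + n + 1 - c = (t - c) + ((n + 1 : ℕ) : ℝ) by push_cast; ring,
        Real.rpow_add hy0, Real.rpow_natCast]
    rw [this, hB, Real.rpow_neg (by norm_num), Real.rpow_neg (by norm_num), div_pow]
    field_simp
  have hD0 : 0 < B * y ^ (-(t + n + 1 - c)) := by positivity
  rw [h4, ENNReal.ofReal_inv_of_pos hD0] at h3
  set D := ENNReal.ofReal (B * y ^ (-(t + n + 1 - c))) with hD
  have hDz : D ≠ 0 := by rw [hD]; simpa using hD0
  have hDt : D ≠ ⊤ := ENNReal.ofReal_ne_top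
  calc ‖f z - f w‖ₑ ^ p
      = ‖f z - f w‖ₑ ^ p * (D⁻¹ * volume (unitBall n)) * (D * (volume (unitBall n))⁻¹) := by
        have : D⁻¹ * volume (unitBall n) * (D * (volume (unitBall n))⁻¹) = 1 := by
          rw [mul_mul_mul_comm, ENNReal.inv_mul_cancel hDz hDt, ENNReal.mul_inv_cancel hV0 hVt,
            one_mul]
        rw [mul_assoc, this, mul_one]
    _ ≤ 2 ^ (p - 1) * (C + C) * J * (D * (volume (unitBall n))⁻¹) := mul_le_mul_left h3 _
    _ = _ := by rw [hD, ENNReal.ofReal_mul hB0.le]; ring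

end LocalOscillation

/-! ### Radial derivatives, growth and radial differences. -/

section Radial

variable {n : ℕ}

theorem ofReal_smul_eq (τ : ℝ) (z : Cn n) : (τ : ℂ) • z = τ • z := by
  ext i; simp

/-- Cauchy's estimate for `l ↦ f(l z) - f(τ z)` on the disc of radius `m/2` about `τ`, with `m = 1 -
τ|z|`. Points `l z` on its boundary circle satisfy the comparability conditions with constant `3`,
and `m ≥ ((1-τ) + (1-|z|))/2`. -/
theorem enorm_deriv_radial_rpow_le {p : ℝ} (hp : 1 ≤ p) {f : Cn n → ℂ}
    (hf : DifferentiableOn ℂ f (unitBall n)) {z : Cn n} (hz : ‖z‖ < 1) {τ : ℝ} (hτ : 0 ≤ τ)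
    (hτ1 : τ ≤ 1) {B : ℝ≥0∞}
    (hB : ∀ w : Cn n, ‖w‖ < 1 → 1 - ‖τ • z‖ ≤ 3 * (1 - ‖w‖) →
      koranyi (τ • z) w ≤ 3 * (1 - ‖τ • z‖) → ‖f (τ • z) - f w‖ₑ ^ p ≤ B) :
    ‖deriv (fun l : ℂ => f (l • z)) τ‖ₑ
      ≤ B ^ (1 / p) * ENNReal.ofReal (4 * ((1 - τ) + (1 - ‖z‖))⁻¹) := by
  have hp0 : 0 < p := by linarith
  set m := 1 - τ * ‖z‖ with hm
  have hz0 := norm_nonneg z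
  have hm0 : 0 < m := by nlinarith
  have hmm : (1 - τ) + (1 - ‖z‖) ≤ 2 * m := by nlinarith
  have hmp : 0 < (1 - τ) + (1 - ‖z‖) := by linarith
  have hτz : ‖τ • z‖ = τ * ‖z‖ := norm_smul_of_nonneg hτ z
  rcases eq_or_ne B ⊤ with hBt | hBt
  · rw [hBt, ENNReal.top_rpow_of_pos (by positivity), ENNReal.top_mul]
    · exact le_top
    · simp only [ne_eq, ENNReal.ofReal_eq_zero, not_le]; positivity
  set K := (B ^ (1 / p)).toReal with hK
  have hBp : B ^ (1 / p) ≠ ⊤ := ENNReal.rpow_ne_top_of_nonneg (by positivity) hBt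
  have hin : ∀ l : ℂ, ‖l - τ‖ ≤ m / 2 → ‖l • z‖ ≤ 1 - m / 2 := by
    intro l hl
    have e1 : ‖l‖ ≤ τ + m / 2 := by
      have := norm_add_le (l - τ) (τ : ℂ)
      rw [sub_add_cancel, Complex.norm_real, Real.norm_of_nonneg hτ] at this
      linarith
    rw [norm_smul]
    nlinarith
  have hbound : ∀ l ∈ Metric.sphere (τ : ℂ) (m / 2), ‖f (l • z) - f (τ • z)‖ ≤ K := by
    intro l hl
    have hl' : ‖l - τ‖ = m / 2 := mem_sphere_iff_norm.1 hl
    have hw := hin l hl'.le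
    have hkor : koranyi (τ • z) (l • z) ≤ 3 * m := by
      rw [koranyi_comm]
      refine (koranyi_le_add (l • z) (τ • z) (τ • z)).trans ?_
      have e1 : koranyi (τ • z) (τ • z) = 1 - (τ * ‖z‖) ^ 2 := by
        rw [koranyi, pairing_self, hτz, ← Complex.ofReal_one, ← Complex.ofReal_sub,
          Complex.norm_real, Real.norm_of_nonneg]
        nlinarith [mul_nonneg hτ hz0]
      have e2 : ‖l • z - τ • z‖ ≤ m / 2 := by
        rw [← ofReal_smul_eq, ← sub_smul, norm_smul, hl']
        nlinarith
      rw [e1, hτz]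
      nlinarith [norm_nonneg (l • z - τ • z), mul_nonneg hτ hz0]
    have h1 := hB (l • z) (by linarith) (by rw [hτz]; linarith) (by rw [hτz]; exact hkor)
    rw [norm_sub_rev]
    have h2 := ENNReal.rpow_le_rpow h1 (by positivity : 0 ≤ 1 / p)
    rw [← ENNReal.rpow_mul, mul_one_div_cancel hp0.ne', ENNReal.rpow_one] at h2
    have h3 := ENNReal.toReal_mono hBp h2
    rwa [toReal_enorm] at h3
  have hd : DiffContOnCl ℂ (fun l : ℂ => f (l • z) - f (τ • z)) (Metric.ball (τ : ℂ) (m / 2)) := by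
    refine DifferentiableOn.diffContOnCl ?_
    refine DifferentiableOn.sub_const (hf.comp (by fun_prop) fun l hl => ?_) _
    have := Metric.closure_ball_subset_closedBall hl
    rw [mem_closedBall_iff_norm] at this
    rw [mem_ball_zero_iff]
    linarith [hin l this]
  have h4 := Complex.norm_deriv_le_of_forall_mem_sphere_norm_le (by positivity) hd hbound
  rw [deriv_sub_const] at h4
  have h5 : K / (m / 2) ≤ K * (4 * ((1 - τ) + (1 - ‖z‖))⁻¹) := by
    rw [div_eq_mul_inv]
    refine mul_le_mul_of_nonneg_left ?_ ENNReal.toReal_nonneg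
    rw [← div_eq_mul_inv, inv_le_comm₀ (by positivity) (by positivity), inv_div]
    linarith
  rw [← ofReal_norm]
  refine (ENNReal.ofReal_le_ofReal (h4.trans h5)).trans (le_of_eq ?_)
  rw [ENNReal.ofReal_mul ENNReal.toReal_nonneg, ENNReal.ofReal_toReal hBp]

theorem enorm_sub_radial_le_lintegral {f : Cn n → ℂ}
    (hf : DifferentiableOn ℂ f (unitBall n)) {z : Cn n} (hz : ‖z‖ < 1) {τ₀ : ℝ} (hτ : 0 ≤ τ₀)
    (hτ1 : τ₀ ≤ 1) :
    ‖f z - f (τ₀ • z)‖ₑ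
      ≤ ∫⁻ τ in Set.Ioo τ₀ 1, ‖deriv (fun l : ℂ => f (l • z)) τ‖ₑ := by
  set U : Set ℂ := {l | ‖l • z‖ < 1} with hU
  have hUo : IsOpen U := isOpen_lt (by fun_prop) continuous_const
  have hd : DifferentiableOn ℂ (fun l : ℂ => f (l • z)) U :=
    hf.comp (by fun_prop) fun l hl => mem_ball_zero_iff.2 hl
  have hmem : ∀ τ ∈ Set.uIcc τ₀ 1, (τ : ℂ) ∈ U := by
    intro τ ht
    rw [Set.uIcc_of_le hτ1] at ht
    have : 0 ≤ τ := hτ.trans ht.1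
    simp only [hU, Set.mem_ofPred_eq, norm_smul, Complex.norm_real, Real.norm_of_nonneg this]
    nlinarith [norm_nonneg z, ht.2]
  have hderiv : ∀ τ ∈ Set.uIcc τ₀ 1, HasDerivAt (fun τ : ℝ => f ((τ : ℂ) • z))
      (deriv (fun l : ℂ => f (l • z)) τ) τ := fun τ ht =>
    ((hd.differentiableAt (hUo.mem_nhds (hmem τ ht))).hasDerivAt).comp_ofReal
  have hcont : ContinuousOn (fun τ : ℝ => deriv (fun l : ℂ => f (l • z)) τ) (Set.uIcc τ₀ 1) :=
    (hd.deriv hUo).continuousOn.comp Complex.continuous_ofReal.continuousOn hmem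
  have h := intervalIntegral.integral_eq_sub_of_hasDerivAt hderiv hcont.intervalIntegrable
  rw [Complex.ofReal_one, one_smul, ofReal_smul_eq, intervalIntegral.integral_of_le hτ1,
    ← integral_Ioc_eq_integral_Ioo.symm] at h
  rw [← h]
  exact enorm_integral_le_lintegral_enorm _

theorem lintegral_one_sub_add_rpow_le {δ y : ℝ} (hδ : 0 < δ) (hy : 0 < y) :
    ∫⁻ τ in Set.Ioo (0 : ℝ) 1, ENNReal.ofReal (((1 - τ) + y) ^ (-1 - δ))
      ≤ ENNReal.ofReal (y ^ (-δ) / δ) := by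
  have hcont : ContinuousOn (fun τ : ℝ => ((1 - τ) + y) ^ (-1 - δ)) (Set.uIcc 0 1) := by
    refine ContinuousOn.rpow_const (by fun_prop) fun τ ht => Or.inl ?_
    rw [Set.uIcc_of_le zero_le_one] at ht
    have := ht.2
    linarith
  have h1 : ∫ τ in (0 : ℝ)..1, ((1 - τ) + y) ^ (-1 - δ) = (y ^ (-δ) - (1 + y) ^ (-δ)) / δ := by
    have : ∀ τ : ℝ, ((1 - τ) + y) ^ (-1 - δ) = (1 + y - τ) ^ (-1 - δ) := fun τ => by
      congr 1; ring
    simp_rw [this]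
    rw [intervalIntegral.integral_comp_sub_left (fun x => x ^ (-1 - δ)) (1 + y), integral_rpow]
    · rw [show -1 - δ + 1 = -δ by ring]
      simp only [add_sub_cancel_left, sub_zero]
      rw [div_neg, ← neg_div, neg_sub]
    · right
      refine ⟨by linarith, ?_⟩
      rw [Set.uIcc_of_le (by linarith)]
      intro h
      have := h.1
      linarith
  rw [setLIntegral_congr Ioo_ae_eq_Ioc, ← ofReal_integral_eq_lintegral_ofReal,
    ← intervalIntegral.integral_of_le zero_le_one, h1]
  · refine ENNReal.ofReal_le_ofReal ?_
    have : 0 ≤ (1 + y) ^ (-δ) := by positivity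
    gcongr
    linarith
  · exact (intervalIntegrable_iff_integrableOn_Ioc_of_le zero_le_one).1 hcont.intervalIntegrable
  · filter_upwards [ae_restrict_mem measurableSet_Ioc] with τ hτ
    exact Real.rpow_nonneg (by linarith [hτ.2]) _

/-- Local differences of size `(1-|τz|)^(-q/p)` bound the radial derivative by a multiple of
`((1-τ)+(1-|z|))^(-1-q/p)`; since `q > 0`, integrating from the origin gives the order
`(1-|z|)^(-q/p)`. The constant depends on `f` through `f 0` and `J`. -/
theorem enorm_rpow_le_growth (hn : 1 ≤ n) {p t c : ℝ} (hp : 1 ≤ p) (hc : 0 ≤ c)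
    (hq : 0 < t + n + 1 - c) {f : Cn n → ℂ} (hfm : Measurable f)
    (hf : DifferentiableOn ℂ f (unitBall n)) {J : ℝ≥0∞} (hJt : J ≠ ⊤)
    (hJ : ∀ a ∈ unitBall n, moebiusIntegral t c (oscIntegral p f) a ≤ J) :
    ∃ C : ℝ≥0∞, C ≠ ⊤ ∧ ∀ z : Cn n, ‖z‖ < 1 →
      ‖f z‖ₑ ^ p ≤ C * ENNReal.ofReal ((1 - ‖z‖) ^ (-(t + n + 1 - c))) := by
  obtain ⟨C, hC, h⟩ := enorm_sub_rpow_le_of_moebiusIntegral_le hn (M := 3) (t := t) hp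
    (by norm_num) hc
  have hp0 : 0 < p := by linarith
  set q := t + n + 1 - c with hqdef
  have hδ : 0 < q / p := by positivity
  set K : ℝ≥0∞ := (C * J) ^ (1 / p) * ENNReal.ofReal (4 * 2 ^ (q / p)) with hK
  have hKt : K ≠ ⊤ := ENNReal.mul_ne_top
    (ENNReal.rpow_ne_top_of_nonneg (by positivity) (ENNReal.mul_ne_top hC hJt)) ENNReal.ofReal_ne_top
  have h2p : (2 : ℝ≥0∞) ^ (p - 1) ≠ ⊤ := ENNReal.rpow_ne_top_of_nonneg (by linarith) (by simp)
  have hKp : (K * ENNReal.ofReal (1 / (q / p))) ^ p ≠ ⊤ :=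
    ENNReal.rpow_ne_top_of_nonneg hp0.le (ENNReal.mul_ne_top hKt ENNReal.ofReal_ne_top)
  have hf0 : ‖f 0‖ₑ ^ p ≠ ⊤ := ENNReal.rpow_ne_top_of_nonneg hp0.le enorm_ne_top
  refine ⟨2 ^ (p - 1) * ((K * ENNReal.ofReal (1 / (q / p))) ^ p + ‖f 0‖ₑ ^ p),
    ENNReal.mul_ne_top h2p (ENNReal.add_ne_top.2 ⟨hKp, hf0⟩), fun z hz => ?_⟩
  have hy0 : 0 < 1 - ‖z‖ := by linarith
  have hder : ∀ τ ∈ Set.Ioo (0 : ℝ) 1, ‖deriv (fun l : ℂ => f (l • z)) τ‖ₑ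
      ≤ K * ENNReal.ofReal (((1 - τ) + (1 - ‖z‖)) ^ (-1 - q / p)) := by
    intro τ hτ
    have hτz : ‖τ • z‖ = τ * ‖z‖ := norm_smul_of_nonneg hτ.1.le z
    have hτz1 : ‖τ • z‖ < 1 := by rw [hτz]; nlinarith [norm_nonneg z, hτ.1, hτ.2]
    have hm0 : 0 < (1 - τ) + (1 - ‖z‖) := by linarith [hτ.2]
    refine (enorm_deriv_radial_rpow_le hp hf hz hτ.1.le hτ.2.le
      (B := C * J * ENNReal.ofReal ((1 - ‖τ • z‖) ^ (-q)))
      fun w hw h1 h2 => h f hfm hf J hJ _ w hτz1 hw h1 h2).trans ?_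
    rw [ENNReal.mul_rpow_of_nonneg _ _ (by positivity), hK, mul_assoc, mul_assoc]
    refine mul_le_mul_right ?_ _
    have hz1 : 0 < 1 - ‖τ • z‖ := by linarith
    rw [ENNReal.ofReal_rpow_of_nonneg (by positivity) (by positivity),
      ← ENNReal.ofReal_mul (by positivity), ← ENNReal.ofReal_mul (by positivity)]
    refine ENNReal.ofReal_le_ofReal ?_
    have e1 : ((1 - ‖τ • z‖) ^ (-q)) ^ (1 / p) = (1 - ‖τ • z‖) ^ (-(q / p)) := by
      rw [← Real.rpow_mul hz1.le]; congr 1; ring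
    have e2 : (1 - ‖τ • z‖) ^ (-(q / p)) ≤ (((1 - τ) + (1 - ‖z‖)) / 2) ^ (-(q / p)) := by
      refine Real.rpow_le_rpow_of_nonpos (by positivity) ?_ (by linarith)
      rw [hτz]; nlinarith [norm_nonneg z, hτ.1, hτ.2]
    have e3 : (((1 - τ) + (1 - ‖z‖)) / 2) ^ (-(q / p))
        = 2 ^ (q / p) * ((1 - τ) + (1 - ‖z‖)) ^ (-(q / p)) := by
      rw [div_eq_mul_inv, Real.mul_rpow hm0.le (by norm_num), Real.inv_rpow (by norm_num),
        Real.rpow_neg two_pos.le, inv_inv, mul_comm]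
    rw [e1, show -1 - q / p = -(q / p) + -1 by ring, Real.rpow_add hm0, Real.rpow_neg_one]
    rw [e3] at e2
    calc _ ≤ 2 ^ (q / p) * ((1 - τ) + (1 - ‖z‖)) ^ (-(q / p)) *
          (4 * ((1 - τ) + (1 - ‖z‖))⁻¹) := by gcongr
      _ = _ := by ring
  have hsub : ‖f z - f 0‖ₑ ≤ K * ENNReal.ofReal (1 / (q / p)) *
      ENNReal.ofReal ((1 - ‖z‖) ^ (-(q / p))) := by
    have h1 := enorm_sub_radial_le_lintegral hf hz le_rfl zero_le_one
    rw [zero_smul] at h1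
    refine h1.trans ((setLIntegral_mono' measurableSet_Ioo hder).trans ?_)
    rw [lintegral_const_mul' _ _ hKt, mul_assoc K, ← ENNReal.ofReal_mul (by positivity)]
    refine mul_le_mul_right ((lintegral_one_sub_add_rpow_le hδ hy0).trans (le_of_eq ?_)) _
    congr 1; ring
  have hsubp : ‖f z - f 0‖ₑ ^ p ≤ (K * ENNReal.ofReal (1 / (q / p))) ^ p *
      ENNReal.ofReal ((1 - ‖z‖) ^ (-q)) := by
    refine (ENNReal.rpow_le_rpow hsub hp0.le).trans (le_of_eq ?_)
    rw [ENNReal.mul_rpow_of_nonneg _ _ hp0.le, ENNReal.ofReal_rpow_of_nonneg (by positivity) hp0.le,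
      ← Real.rpow_mul hy0.le]
    congr 3; field_simp
  have hone : 1 ≤ ENNReal.ofReal ((1 - ‖z‖) ^ (-q)) := by
    rw [← ENNReal.ofReal_one]
    exact ENNReal.ofReal_le_ofReal (Real.one_le_rpow_of_pos_of_le_one_of_nonpos hy0
      (by linarith [norm_nonneg z]) (by linarith))
  calc ‖f z‖ₑ ^ p = ‖(f z - f 0) - (-f 0)‖ₑ ^ p := by congr 2; ring
    _ ≤ 2 ^ (p - 1) * (‖f z - f 0‖ₑ ^ p + ‖-f 0‖ₑ ^ p) := enorm_sub_rpow_le hp _ _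
    _ ≤ 2 ^ (p - 1) * ((K * ENNReal.ofReal (1 / (q / p))) ^ p *
          ENNReal.ofReal ((1 - ‖z‖) ^ (-q)) + ‖f 0‖ₑ ^ p * ENNReal.ofReal ((1 - ‖z‖) ^ (-q))) := by
        rw [enorm_neg]
        gcongr
        exact le_mul_of_one_le_right' hone
    _ = _ := by ring

/-- Hölder against the density `ρ(τ) = y^δ ((1-τ)+y)^(-1-δ)`, with `y = 1-|z|`, whose mass is at
most `1/δ` whatever `z` is. The price is the factor `y^(-(p-1)δ)`, harmless later once `δ` is small.
-/
theorem enorm_sub_radial_rpow_le (hn : 1 ≤ n) {p δ : ℝ} (hp : 1 ≤ p) (hδ : 0 < δ) :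
    ∃ C : ℝ≥0∞, C ≠ ⊤ ∧ ∀ f : Cn n → ℂ, Measurable f → DifferentiableOn ℂ f (unitBall n) →
      ∀ z : Cn n, ‖z‖ < 1 → ∀ τ₀ : ℝ, 0 ≤ τ₀ → τ₀ ≤ 1 →
        ‖f z - f (τ₀ • z)‖ₑ ^ p ≤ C * ∫⁻ τ in Set.Ioo τ₀ 1, oscIntegral p f (τ • z) *
          ENNReal.ofReal (((1 - τ) + (1 - ‖z‖)) ^ ((p - 1) * δ - 1) *
            (1 - ‖z‖) ^ (-((p - 1) * δ))) := by
  obtain ⟨C, hC, h⟩ := enorm_sub_rpow_le_oscIntegral hn hp (M := 3) (by norm_num)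
  have hp0 : 0 < p := by linarith
  refine ⟨ENNReal.ofReal (1 / δ) ^ (p - 1) * (C * ENNReal.ofReal (4 ^ p)),
    ENNReal.mul_ne_top (ENNReal.rpow_ne_top_of_nonneg (by linarith) ENNReal.ofReal_ne_top)
      (by finiteness), fun f hfm hf z hz τ₀ hτ₀ hτ₀1 => ?_⟩
  set y := 1 - ‖z‖ with hy
  have hy0 : 0 < y := by linarith
  set k : ℝ → ℝ≥0∞ := fun τ => (C * oscIntegral p f (τ • z)) ^ (1 / p) *
    ENNReal.ofReal (4 * ((1 - τ) + y)⁻¹) with hk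
  have hosc := measurable_oscIntegral (p := p) hfm
  have hoscτ : Measurable fun τ : ℝ => oscIntegral p f (τ • z) :=
    hosc.comp (by fun_prop : Measurable fun τ : ℝ => τ • z)
  have hkm : Measurable k := by fun_prop
  set ρ : ℝ → ℝ≥0∞ := fun τ => ENNReal.ofReal (y ^ δ * ((1 - τ) + y) ^ (-1 - δ)) with hρ
  have hρm : Measurable ρ := by fun_prop
  set μ : Measure ℝ := (volume.restrict (Set.Ioo τ₀ 1)).withDensity ρ with hμ
  -- This is `k/ρ`, so integrating `φ` against `μ` recovers the integral of `k`.
  set φ : ℝ → ℝ≥0∞ := fun τ => k τ * ENNReal.ofReal (y ^ (-δ) * ((1 - τ) + y) ^ (1 + δ)) with hφ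
  have hφm : Measurable φ := by fun_prop
  have hder : ∀ τ ∈ Set.Ioo τ₀ 1, ‖deriv (fun l : ℂ => f (l • z)) τ‖ₑ ≤ k τ := by
    intro τ hτ
    have hτ0 : 0 ≤ τ := hτ₀.trans hτ.1.le
    have hτz1 : ‖τ • z‖ < 1 := by
      rw [norm_smul_of_nonneg hτ0]; nlinarith [norm_nonneg z, hτ.2]
    exact enorm_deriv_radial_rpow_le hp hf hz hτ0 hτ.2.le
      fun w hw h1 h2 => h f hfm hf _ w hτz1 hw h1 h2
  have hcancel : ∀ τ ∈ Set.Ioo τ₀ 1, ρ τ * φ τ = k τ := by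
    intro τ hτ
    have hm0 : 0 < (1 - τ) + y := by linarith [hτ.2]
    simp only [hρ, hφ]
    rw [mul_left_comm, ← ENNReal.ofReal_mul (by positivity)]
    have : y ^ δ * ((1 - τ) + y) ^ (-1 - δ) * (y ^ (-δ) * ((1 - τ) + y) ^ (1 + δ)) = 1 := by
      rw [mul_mul_mul_comm, ← Real.rpow_add hy0, ← Real.rpow_add hm0]
      simp
    rw [this, ENNReal.ofReal_one, mul_one]
  have hmass : μ Set.univ ≤ ENNReal.ofReal (1 / δ) := by
    rw [hμ, withDensity_apply _ MeasurableSet.univ, Measure.restrict_univ]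
    calc ∫⁻ τ in Set.Ioo τ₀ 1, ρ τ
        ≤ ∫⁻ τ in Set.Ioo 0 1, ENNReal.ofReal (y ^ δ) *
            ENNReal.ofReal (((1 - τ) + y) ^ (-1 - δ)) := by
          refine (lintegral_mono_set (Set.Ioo_subset_Ioo_left hτ₀)).trans (le_of_eq ?_)
          refine lintegral_congr fun τ => ?_
          rw [← ENNReal.ofReal_mul (by positivity)]
      _ ≤ ENNReal.ofReal (y ^ δ) * ENNReal.ofReal (y ^ (-δ) / δ) := by
          rw [lintegral_const_mul' _ _ ENNReal.ofReal_ne_top]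
          exact mul_le_mul_right (lintegral_one_sub_add_rpow_le hδ hy0) _
      _ = _ := by
          rw [← ENNReal.ofReal_mul (by positivity)]
          congr 1
          rw [mul_div_assoc', ← Real.rpow_add hy0]; simp
  calc ‖f z - f (τ₀ • z)‖ₑ ^ p
      ≤ (∫⁻ τ in Set.Ioo τ₀ 1, ‖deriv (fun l : ℂ => f (l • z)) τ‖ₑ) ^ p :=
        ENNReal.rpow_le_rpow (enorm_sub_radial_le_lintegral hf hz hτ₀ hτ₀1) hp0.le
    _ ≤ (∫⁻ τ in Set.Ioo τ₀ 1, ρ τ * φ τ) ^ p :=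
        ENNReal.rpow_le_rpow (setLIntegral_mono' measurableSet_Ioo fun τ hτ =>
          (hder τ hτ).trans (hcancel τ hτ).ge) hp0.le
    _ = (∫⁻ τ, φ τ ∂μ) ^ p := by
        rw [hμ, lintegral_withDensity_eq_lintegral_mul _ hρm hφm]; rfl
    _ ≤ μ Set.univ ^ (p - 1) * ∫⁻ τ, φ τ ^ p ∂μ :=
        lintegral_rpow_le_measure_univ_mul hp hφm.aemeasurable
    _ ≤ ENNReal.ofReal (1 / δ) ^ (p - 1) * ∫⁻ τ, φ τ ^ p ∂μ :=
        mul_le_mul_left (ENNReal.rpow_le_rpow hmass (by linarith)) _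
    _ = ENNReal.ofReal (1 / δ) ^ (p - 1) * ∫⁻ τ in Set.Ioo τ₀ 1, C * ENNReal.ofReal (4 ^ p) *
          (oscIntegral p f (τ • z) * ENNReal.ofReal (((1 - τ) + y) ^ ((p - 1) * δ - 1) *
            y ^ (-((p - 1) * δ)))) := by
        congr 1
        rw [hμ, lintegral_withDensity_eq_lintegral_mul _ hρm (hφm.pow_const _)]
        refine setLIntegral_congr_fun measurableSet_Ioo fun τ hτ => ?_
        have hm0 : 0 < (1 - τ) + y := by linarith [hτ.2]
        simp only [Pi.mul_apply, hφ, hk, hρ]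
        rw [ENNReal.mul_rpow_of_nonneg _ _ hp0.le, ENNReal.mul_rpow_of_nonneg _ _ hp0.le,
          ← ENNReal.rpow_mul, one_div_mul_cancel hp0.ne', ENNReal.rpow_one,
          ENNReal.ofReal_rpow_of_nonneg (by positivity) hp0.le,
          ENNReal.ofReal_rpow_of_nonneg (by positivity) hp0.le]
        have e1 : y ^ δ * ((1 - τ) + y) ^ (-1 - δ) * ((4 * ((1 - τ) + y)⁻¹) ^ p *
            (y ^ (-δ) * ((1 - τ) + y) ^ (1 + δ)) ^ p)
            = 4 ^ p * (((1 - τ) + y) ^ ((p - 1) * δ - 1) * y ^ (-((p - 1) * δ))) := by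
          rw [Real.mul_rpow (by norm_num) (by positivity), Real.mul_rpow (by positivity)
            (by positivity), ← Real.rpow_neg_one, ← Real.rpow_mul hm0.le, ← Real.rpow_mul hm0.le,
            ← Real.rpow_mul hy0.le,
            show -((p - 1) * δ) = δ + -δ * p by ring,
            show (p - 1) * δ - 1 = (-1 - δ) + (-1 * p) + (1 + δ) * p by ring,
            Real.rpow_add hy0, Real.rpow_add hm0, Real.rpow_add hm0]
          ring
        calc _ = C * oscIntegral p f (τ • z) * (ENNReal.ofReal (y ^ δ * ((1 - τ) + y) ^ (-1 - δ)) *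
              (ENNReal.ofReal ((4 * ((1 - τ) + y)⁻¹) ^ p) *
                ENNReal.ofReal ((y ^ (-δ) * ((1 - τ) + y) ^ (1 + δ)) ^ p))) := by ring
          _ = C * oscIntegral p f (τ • z) * (ENNReal.ofReal (4 ^ p) * ENNReal.ofReal
                (((1 - τ) + y) ^ ((p - 1) * δ - 1) * y ^ (-((p - 1) * δ)))) := by
              rw [← ENNReal.ofReal_mul (by positivity), ← ENNReal.ofReal_mul (by positivity), e1,
                ENNReal.ofReal_mul (by positivity)]
          _ = _ := by ring
    _ = _ := by
        rw [lintegral_const_mul' _ _ (by finiteness)]; ring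

end Radial

/-! ### The Hardy-type inequality and the conclusion. -/

section Main

variable {n : ℕ}

/-- The total exponent is `2c + (t+n+1-c) = n+1+t+c`, so Forelli–Rudin yields `(1-|a|²)^(-c)`,
cancelling the weight's factor. -/
theorem moebiusIntegral_koranyi_le (hn : 1 ≤ n) {t c : ℝ} (ht : -1 < t) (hc : 0 < c) :
    ∃ C : ℝ≥0∞, C ≠ ⊤ ∧ ∀ a ∈ unitBall n, moebiusIntegral t c
      (fun z => ENNReal.ofReal (koranyi z a ^ (-(t + n + 1 - c)))) a ≤ C := by
  obtain ⟨C, hC, h⟩ := lintegral_koranyi_rpow_le hn ht hc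
  refine ⟨C * ENNReal.ofReal (2 ^ c * 2 ^ c), by finiteness, fun a ha => ?_⟩
  have ha1 := mem_ball_zero_iff.1 ha
  have ha2 : 0 < 1 - ‖a‖ ^ 2 := by nlinarith [norm_nonneg a]
  calc _ ≤ ∫⁻ z, ENNReal.ofReal ((1 - ‖a‖ ^ 2) ^ c) *
          ENNReal.ofReal (koranyi z a ^ (-(n + 1 + t + c))) ∂(powMeasure n t) := by
        refine lintegral_mono_ae ?_
        filter_upwards [ae_powMeasure_mem (n := n) t] with z hz
        have hk := koranyi_pos (mem_ball_zero_iff.1 hz) ha1.le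
        rw [← ENNReal.ofReal_mul (by positivity), ← ENNReal.ofReal_mul (by positivity)]
        refine ENNReal.ofReal_le_ofReal (le_of_eq ?_)
        rw [mul_left_comm, ← Real.rpow_add hk]
        congr 2; ring
    _ ≤ ENNReal.ofReal ((1 - ‖a‖ ^ 2) ^ c) * (C * ENNReal.ofReal ((1 - ‖a‖ ^ 2) ^ (-c))) := by
        rw [lintegral_const_mul' _ _ ENNReal.ofReal_ne_top]
        exact mul_le_mul_right (h a ha1) _
    _ = C := by
        rw [mul_left_comm, ← ENNReal.ofReal_mul (by positivity), ← Real.rpow_add ha2]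
        simp
    _ ≤ _ := by
        refine le_mul_of_one_le_right' ?_
        rw [← ENNReal.ofReal_one]
        refine ENNReal.ofReal_le_ofReal ?_
        have := Real.one_le_rpow one_le_two hc.le
        nlinarith

/-- Write `z = u/τ`. The restriction on `τ` bounds `|u - z|` by a quarter of `|1-⟨z,a⟩|`, so that
quantity may be evaluated at `u` instead. Moreover `(1-τ)+(1-|z|)` is comparable to `1-|u|`, and
`1-|z|` to `τ-|u|`. -/
theorem radial_kernel_le {t c ε τ : ℝ} (hc : 0 ≤ c) (hε : 0 ≤ ε) {a u : Cn n} (ha : ‖a‖ < 1)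
    (hτ : 1 / 2 < τ) (hτ1 : τ < 1) (hu : ‖u‖ < τ) (h : 1 - koranyi (τ⁻¹ • u) a / 4 < τ) :
    (1 - ‖τ⁻¹ • u‖ ^ 2) ^ t *
        ((((1 - τ) + (1 - ‖τ⁻¹ • u‖)) ^ (ε - 1) * (1 - ‖τ⁻¹ • u‖) ^ (-ε)) *
          ((1 - ‖a‖ ^ 2) ^ c * koranyi (τ⁻¹ • u) a ^ (-(2 * c))))
      ≤ 2 ^ |ε - 1| * 2 ^ (2 * c) * 4 ^ |t| * (1 - ‖u‖) ^ (ε - 1) *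
          ((1 - ‖a‖ ^ 2) ^ c * koranyi u a ^ (-(2 * c))) * (τ - ‖u‖) ^ (t - ε) := by
  have hτ0 : 0 < τ := by linarith
  have ha2 : 0 < 1 - ‖a‖ ^ 2 := by nlinarith [norm_nonneg a]
  have hu1 : ‖u‖ < 1 := by linarith
  have hku := koranyi_pos hu1 ha.le
  have hy0 : 0 < 1 - ‖u‖ := by linarith
  obtain ⟨b1, b2⟩ := one_sub_norm_inv_smul_sq_bounds hτ hτ1 hu
  have e2 := inv_smul_sub_norm_le hτ0 hτ1.le hu.le
  have hzn : τ * ‖τ⁻¹ • u‖ = ‖u‖ := by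
    rw [← norm_smul_of_nonneg hτ0.le, smul_smul, mul_inv_cancel₀ hτ0.ne', one_smul]
  generalize τ⁻¹ • u = z at *
  have hx0 : 0 < τ - ‖u‖ := by linarith
  have hz0 := norm_nonneg z
  have hz1 : ‖z‖ < 1 := by nlinarith
  have hkz := koranyi_pos hz1 ha.le
  have hm0 : 0 < (1 - τ) + (1 - ‖z‖) := by linarith
  have f1 : ((1 - τ) + (1 - ‖z‖)) ^ (ε - 1) ≤ 2 ^ |ε - 1| * (1 - ‖u‖) ^ (ε - 1) :=
    rpow_le_of_comparable hy0 one_le_two (by nlinarith) (by nlinarith) _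
  have f2 : (1 - ‖z‖) ^ (-ε) ≤ (τ - ‖u‖) ^ (-ε) :=
    Real.rpow_le_rpow_of_nonpos hx0 (by nlinarith) (by linarith)
  have f3 : (1 - ‖z‖ ^ 2) ^ t ≤ 4 ^ |t| * (τ - ‖u‖) ^ t :=
    rpow_le_of_comparable hx0 (by norm_num) (by linarith) (by linarith) _
  have f4 : koranyi z a ^ (-(2 * c)) ≤ 2 ^ (2 * c) * koranyi u a ^ (-(2 * c)) := by
    have e1 := koranyi_le_add u z a
    have e3 : koranyi u a / 2 ≤ koranyi z a := by
      nlinarith [norm_nonneg (u - z), norm_nonneg a]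
    refine (Real.rpow_le_rpow_of_nonpos (by positivity) e3 (by linarith)).trans (le_of_eq ?_)
    rw [div_eq_mul_inv, Real.mul_rpow hku.le (by norm_num), Real.inv_rpow (by norm_num),
      Real.rpow_neg two_pos.le, inv_inv, mul_comm]
  have hz2 : 0 < 1 - ‖z‖ := by linarith
  calc _ ≤ (4 ^ |t| * (τ - ‖u‖) ^ t) *
        (((2 ^ |ε - 1| * (1 - ‖u‖) ^ (ε - 1)) * (τ - ‖u‖) ^ (-ε)) *
          ((1 - ‖a‖ ^ 2) ^ c * (2 ^ (2 * c) * koranyi u a ^ (-(2 * c))))) := by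
        gcongr
    _ = _ := by
        rw [sub_eq_add_neg t ε, Real.rpow_add hx0]
        ring

/-- Radial averages over `1 - |1 - ⟨z, a⟩| / 4 < τ < 1` are bounded with respect to the weights of
the Möbius integrals. -/
theorem moebiusIntegral_radial_le {t c ε : ℝ} (hc : 0 ≤ c) (hε : 0 ≤ ε)
    (hεt : ε < t + 1) :
    ∃ C : ℝ≥0∞, C ≠ ⊤ ∧ ∀ H : Cn n → ℝ≥0∞, Measurable H → ∀ a ∈ unitBall n,
      moebiusIntegral t c (fun z => ∫⁻ τ in Set.Ioo (1 - koranyi z a / 4) 1, H (τ • z) *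
          ENNReal.ofReal (((1 - τ) + (1 - ‖z‖)) ^ (ε - 1) * (1 - ‖z‖) ^ (-ε))) a
        ≤ C * moebiusIntegral t c H a := by
  set d := Module.finrank ℝ (Cn n)
  set B : ℝ := 2 ^ |ε - 1| * 2 ^ (2 * c) * 4 ^ |t| with hB
  have hB0 : 0 < B := by positivity
  have hs : 0 < t - ε + 1 := by linarith
  refine ⟨ENNReal.ofReal (2 ^ d) * ENNReal.ofReal (B / (t - ε + 1) * 2 ^ |t|),
    by finiteness, fun H hH a ha => ?_⟩
  have ha1 := mem_ball_zero_iff.1 ha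
  have ha2 : 0 < 1 - ‖a‖ ^ 2 := by nlinarith [norm_nonneg a]
  have hka := (continuous_koranyi_left a).measurable
  set W : ℝ → Cn n → ℝ≥0∞ := fun τ z => ENNReal.ofReal ((1 - ‖z‖ ^ 2) ^ t) *
    (H (τ • z) * ENNReal.ofReal (((1 - τ) + (1 - ‖z‖)) ^ (ε - 1) * (1 - ‖z‖) ^ (-ε)) *
      ENNReal.ofReal ((1 - ‖a‖ ^ 2) ^ c * koranyi z a ^ (-(2 * c)))) with hW
  have hHτ : Measurable fun x : ℝ × Cn n => H (x.1 • x.2) := hH.comp (by fun_prop)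
  have hWm : Measurable fun x : ℝ × Cn n => W x.1 x.2 := by fun_prop
  set G : ℝ → Cn n → ℝ≥0∞ := fun τ z =>
    {x : ℝ × Cn n | 1 - koranyi x.2 a / 4 < x.1}.indicator (fun x => W x.1 x.2) (τ, z) with hG
  have hGm : Measurable (Function.uncurry G) := by
    refine hWm.indicator (measurableSet_lt ?_ measurable_fst)
    fun_prop
  have hleft : moebiusIntegral t c (fun z => ∫⁻ τ in Set.Ioo (1 - koranyi z a / 4) 1, H (τ • z) *
      ENNReal.ofReal (((1 - τ) + (1 - ‖z‖)) ^ (ε - 1) * (1 - ‖z‖) ^ (-ε))) a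
      = ∫⁻ z in unitBall n, ∫⁻ τ in Set.Ioo (1 / 2 : ℝ) 1, G τ z := by
    rw [moebiusIntegral, lintegral_powMeasure]
    refine setLIntegral_congr_fun Metric.isOpen_ball.measurableSet fun z hz => ?_
    have hk2 := koranyi_lt_two (mem_ball_zero_iff.1 hz) ha1.le
    rw [← lintegral_mul_const' _ _ ENNReal.ofReal_ne_top,
      ← lintegral_const_mul' _ _ ENNReal.ofReal_ne_top, ← lintegral_indicator measurableSet_Ioo,
      ← lintegral_indicator measurableSet_Ioo]
    refine lintegral_congr fun τ => ?_
    by_cases h1 : 1 - koranyi z a / 4 < τ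
    · have h2 : 1 / 2 < τ := by linarith
      by_cases h3 : τ < 1
      · rw [Set.indicator_of_mem (Set.mem_Ioo.2 ⟨h1, h3⟩), Set.indicator_of_mem (Set.mem_Ioo.2 ⟨h2, h3⟩)]
        simp only [hG]
        rw [Set.indicator_of_mem (by exact h1)]
      · simp [Set.indicator, h3]
    · simp [Set.indicator, hG, h1]
  rw [hleft]
  refine (lintegral_radial_average_le hGm).trans ?_
  rw [mul_assoc]
  refine mul_le_mul_right ?_ _
  rw [moebiusIntegral, lintegral_powMeasure, ← lintegral_const_mul' _ _ ENNReal.ofReal_ne_top]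
  refine setLIntegral_mono' Metric.isOpen_ball.measurableSet fun u hu => ?_
  have hu1 := mem_ball_zero_iff.1 hu
  have hku := koranyi_pos hu1 ha1.le
  set y := 1 - ‖u‖ with hy
  have hy0 : 0 < y := by linarith
  set E : ℝ := B * y ^ (ε - 1) * ((1 - ‖a‖ ^ 2) ^ c * koranyi u a ^ (-(2 * c))) with hE
  have hE0 : 0 ≤ E := by positivity
  have key : ∀ τ ∈ Set.Ioo (max (1 / 2) ‖u‖) 1,
      G τ (τ⁻¹ • u) ≤ H u * ENNReal.ofReal E * ENNReal.ofReal ((τ - ‖u‖) ^ (t - ε)) := by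
    intro τ hτ
    obtain ⟨hτm, hτ1⟩ := hτ
    obtain ⟨hτh, hτu⟩ := max_lt_iff.1 hτm
    have hτ0 : 0 < τ := by linarith
    by_cases h1 : 1 - koranyi (τ⁻¹ • u) a / 4 < τ
    · simp only [hG]
      rw [Set.indicator_of_mem (by exact h1)]
      simp only [hW]
      set z := τ⁻¹ • u with hz
      have hzu : τ • z = u := by rw [hz, smul_smul, mul_inv_cancel₀ hτ0.ne', one_smul]
      have hzn : τ * ‖z‖ = ‖u‖ := by rw [← hzu, norm_smul_of_nonneg hτ0.le]
      have hz1 : ‖z‖ < 1 := by nlinarith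
      have hm0 : 0 < (1 - τ) + (1 - ‖z‖) := by linarith
      have hz2 : 0 < 1 - ‖z‖ := by linarith
      have hz3 : 0 < 1 - ‖z‖ ^ 2 := by nlinarith [norm_nonneg z]
      rw [hzu]
      calc _ = H u * ENNReal.ofReal ((1 - ‖z‖ ^ 2) ^ t *
            ((((1 - τ) + (1 - ‖z‖)) ^ (ε - 1) * (1 - ‖z‖) ^ (-ε)) *
              ((1 - ‖a‖ ^ 2) ^ c * koranyi z a ^ (-(2 * c))))) := by
            rw [mul_assoc (H u), mul_left_comm, ← ENNReal.ofReal_mul (by positivity),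
              ← ENNReal.ofReal_mul (by positivity)]
        _ ≤ H u * ENNReal.ofReal (E * (τ - ‖u‖) ^ (t - ε)) := by
            refine mul_le_mul_right (ENNReal.ofReal_le_ofReal ?_) _
            exact radial_kernel_le hc hε ha1 hτh hτ1 hτu h1
        _ = _ := by rw [ENNReal.ofReal_mul hE0, mul_assoc]
    · simp [hG, h1]
  calc _ ≤ ∫⁻ τ in Set.Ioo (max (1 / 2) ‖u‖) 1,
          H u * ENNReal.ofReal E * ENNReal.ofReal ((τ - ‖u‖) ^ (t - ε)) :=
        setLIntegral_mono' measurableSet_Ioo key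
    _ ≤ ∫⁻ τ in Set.Ioo ‖u‖ 1,
          H u * ENNReal.ofReal E * ENNReal.ofReal ((τ - ‖u‖) ^ (t - ε)) :=
        lintegral_mono_set (Set.Ioo_subset_Ioo_left (le_max_right _ _))
    -- Here `ε < t + 1` gives convergence at `τ = |u|`. Together with `y^(ε-1)` from `E` the result
    -- is `y^t`, the original weight.
    _ = H u * ENNReal.ofReal E * ENNReal.ofReal (y ^ (t - ε + 1) / (t - ε + 1)) := by
        rw [lintegral_const_mul _ (by fun_prop), lintegral_Ioo_sub_rpow (by linarith) hu1.le]
    _ = H u * ENNReal.ofReal (E * (y ^ (t - ε + 1) / (t - ε + 1))) := by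
        rw [ENNReal.ofReal_mul hE0, mul_assoc]
    _ ≤ H u * ENNReal.ofReal (B / (t - ε + 1) * 2 ^ |t| * ((1 - ‖u‖ ^ 2) ^ t *
          ((1 - ‖a‖ ^ 2) ^ c * koranyi u a ^ (-(2 * c))))) := by
        refine mul_le_mul_right (ENNReal.ofReal_le_ofReal ?_) _
        have hu2 : 0 < 1 - ‖u‖ ^ 2 := by nlinarith [norm_nonneg u]
        have g1 : y ^ t ≤ 2 ^ |t| * (1 - ‖u‖ ^ 2) ^ t :=
          rpow_le_of_comparable hu2 one_le_two (by nlinarith [norm_nonneg u])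
            (by nlinarith [norm_nonneg u]) _
        have g2 : y ^ (ε - 1) * y ^ (t - ε + 1) = y ^ t := by
          rw [← Real.rpow_add hy0]; congr 1; ring
        calc E * (y ^ (t - ε + 1) / (t - ε + 1))
            = B / (t - ε + 1) * (y ^ (ε - 1) * y ^ (t - ε + 1)) *
                ((1 - ‖a‖ ^ 2) ^ c * koranyi u a ^ (-(2 * c))) := by rw [hE]; ring
          _ ≤ B / (t - ε + 1) * (2 ^ |t| * (1 - ‖u‖ ^ 2) ^ t) *
                ((1 - ‖a‖ ^ 2) ^ c * koranyi u a ^ (-(2 * c))) := by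
              rw [g2]; gcongr
          _ = _ := by ring
    _ = _ := by
        have hu2 : 0 < 1 - ‖u‖ ^ 2 := by nlinarith [norm_nonneg u]
        rw [mul_left_comm _ (H u), mul_left_comm _ (H u), ← ENNReal.ofReal_mul (by positivity),
          ← ENNReal.ofReal_mul (by positivity)]

theorem moebiusIntegral_enorm_rpow_le (hn : 1 ≤ n) {p t c : ℝ} (hp : 1 ≤ p) (ht : -1 < t)
    (hc : 0 < c) (hq : 0 < t + n + 1 - c) {f : Cn n → ℂ} (hfm : Measurable f)
    (hf : DifferentiableOn ℂ f (unitBall n)) {J : ℝ≥0∞} (hJt : J ≠ ⊤)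
    (hJ : ∀ a ∈ unitBall n, moebiusIntegral t c (oscIntegral p f) a ≤ J) :
    ∃ C : ℝ≥0∞, C ≠ ⊤ ∧ ∀ a ∈ unitBall n, moebiusIntegral t c (fun z => ‖f z‖ₑ ^ p) a ≤ C := by
  have hp0 : 0 < p := by linarith
  -- Chosen so that the loss `ε = (p-1)δ < pδ = (t+1)/2` stays below `t + 1`.
  set δ := (t + 1) / (2 * p) with hδdef
  have hδ : 0 < δ := div_pos (by linarith) (by linarith)
  have hε0 : 0 ≤ (p - 1) * δ := mul_nonneg (by linarith) hδ.le
  have hεt : (p - 1) * δ < t + 1 := by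
    have : p * δ = (t + 1) / 2 := by rw [hδdef]; field_simp
    nlinarith
  obtain ⟨C₁, hC₁, h₁⟩ := enorm_rpow_le_growth hn hp hc.le hq hfm hf hJt hJ
  obtain ⟨C₂, hC₂, h₂⟩ := moebiusIntegral_koranyi_le hn ht hc
  obtain ⟨C₃, hC₃, h₃⟩ := enorm_sub_radial_rpow_le hn hp hδ
  obtain ⟨C₄, hC₄, h₄⟩ := moebiusIntegral_radial_le (n := n) hc.le hε0 hεt
  have h2p : (2 : ℝ≥0∞) ^ (p - 1) ≠ ⊤ := ENNReal.rpow_ne_top_of_nonneg (by linarith) (by simp)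
  set q := t + n + 1 - c with hqdef
  refine ⟨2 ^ (p - 1) * (C₁ * ENNReal.ofReal (4 ^ q) * C₂ + C₃ * (C₄ * J)), by finiteness,
    fun a ha => ?_⟩
  have ha1 := mem_ball_zero_iff.1 ha
  have hka := (continuous_koranyi_left a).measurable
  set F₁ : Cn n → ℝ≥0∞ := fun z => ENNReal.ofReal (koranyi z a ^ (-q)) with hF₁
  set F₂ : Cn n → ℝ≥0∞ := fun z => ∫⁻ τ in Set.Ioo (1 - koranyi z a / 4) 1,
    oscIntegral p f (τ • z) * ENNReal.ofReal (((1 - τ) + (1 - ‖z‖)) ^ ((p - 1) * δ - 1) *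
      (1 - ‖z‖) ^ (-((p - 1) * δ))) with hF₂
  have hF₁m : Measurable F₁ := by fun_prop
  have hpt : ∀ z ∈ unitBall n, ‖f z‖ₑ ^ p
      ≤ 2 ^ (p - 1) * (C₁ * ENNReal.ofReal (4 ^ q) * F₁ z + C₃ * F₂ z) := by
    intro z hz
    have hz1 := mem_ball_zero_iff.1 hz
    have hk0 := koranyi_pos hz1 ha1.le
    have hk2 := koranyi_lt_two hz1 ha1.le
    -- At `τ₀ z` the distance to the sphere is at least `|1-⟨z,a⟩|/4`, which turns the growth bound
    -- into `F₁`; the remaining segment is short enough for `moebiusIntegral_radial_le`.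
    set τ₀ := 1 - koranyi z a / 4 with hτ₀
    have hτ0 : 0 ≤ τ₀ := by linarith
    have hτ1 : τ₀ ≤ 1 := by linarith
    have e0 : ‖τ₀ • z‖ = τ₀ * ‖z‖ := norm_smul_of_nonneg hτ0 z
    have e1 : koranyi z a / 4 ≤ 1 - ‖τ₀ • z‖ := by
      rw [e0]; nlinarith [norm_nonneg z]
    have g1 : ‖f (τ₀ • z)‖ₑ ^ p ≤ C₁ * ENNReal.ofReal (4 ^ q) * F₁ z := by
      refine (h₁ (τ₀ • z) (by linarith)).trans ?_
      rw [hF₁, mul_assoc, ← ENNReal.ofReal_mul (by positivity)]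
      refine mul_le_mul_right (ENNReal.ofReal_le_ofReal ?_) _
      refine (Real.rpow_le_rpow_of_nonpos (by positivity) e1 (by linarith)).trans (le_of_eq ?_)
      rw [div_eq_mul_inv, Real.mul_rpow hk0.le (by norm_num), Real.inv_rpow (by norm_num),
        Real.rpow_neg (by norm_num : (0 : ℝ) ≤ 4), inv_inv, mul_comm]
    have g2 := h₃ f hfm hf z hz1 τ₀ hτ0 hτ1
    calc ‖f z‖ₑ ^ p = ‖f (τ₀ • z) - -(f z - f (τ₀ • z))‖ₑ ^ p := by congr 2; ring
      _ ≤ 2 ^ (p - 1) * (‖f (τ₀ • z)‖ₑ ^ p + ‖-(f z - f (τ₀ • z))‖ₑ ^ p) :=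
          enorm_sub_rpow_le hp _ _
      _ ≤ _ := by
          rw [enorm_neg]
          gcongr
  calc moebiusIntegral t c (fun z => ‖f z‖ₑ ^ p) a
      ≤ moebiusIntegral t c (fun z =>
          2 ^ (p - 1) * (C₁ * ENNReal.ofReal (4 ^ q) * F₁ z + C₃ * F₂ z)) a :=
        moebiusIntegral_mono _ _ hpt a
    _ = 2 ^ (p - 1) * (C₁ * ENNReal.ofReal (4 ^ q) * moebiusIntegral t c F₁ a
          + C₃ * moebiusIntegral t c F₂ a) := by
        rw [moebiusIntegral_const_mul _ _ h2p, ← moebiusIntegral_const_mul _ _ hC₃,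
          ← moebiusIntegral_const_mul _ _ (by finiteness : C₁ * ENNReal.ofReal (4 ^ q) ≠ ⊤)]
        congr 1
        simp only [moebiusIntegral, add_mul]
        exact lintegral_add_left (by fun_prop) _
    _ ≤ _ := by
        gcongr
        · exact h₂ a ha
        · exact (h₄ _ (measurable_oscIntegral hfm) a ha).trans (mul_le_mul_right (hJ a ha) _)

end Main

theorem theorem3p3 (n : ℕ) (hn : 1 ≤ n) (p q s : ℝ) (hp : 1 ≤ p) (hq : 0 < q)
    (hs : max 0 (1 - q / n) < s) (f : Cn n → ℂ) (hf : DifferentiableOn ℂ f (unitBall n)) :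
    (oscFunctional p q s f < ⊤ → f ∈ NSpace n p q s) ∧
      (q + n * s < n + 1 → (f ∈ NSpace n p q s ↔ oscFunctional p q s f < ⊤)) := by
  have hn0 : (0 : ℝ) < n := by exact_mod_cast hn
  obtain ⟨hs0, hs1⟩ := max_lt_iff.1 hs
  have hns : 0 < (n : ℝ) * s := by positivity
  have ht : -1 < q + n * s - n - 1 := by
    have h := mul_lt_mul_of_pos_left hs1 hn0
    have : (n : ℝ) * (1 - q / n) = n - q := by field_simp
    linarith
  -- Values outside the ball do not affect either condition; cutting `f` off there makes it
  -- measurable on the whole space.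
  set g : Cn n → ℂ := (unitBall n).indicator f with hg
  have hgf : ∀ z ∈ unitBall n, g z = f z := fun z hz => Set.indicator_of_mem hz f
  have hgd : DifferentiableOn ℂ g (unitBall n) := hf.congr hgf
  have hgm : Measurable g := by
    have hB : MeasurableSet (unitBall n) := Metric.isOpen_ball.measurableSet
    classical
    rw [hg, ← Set.piecewise_eq_indicator]
    exact hf.continuousOn.measurable_piecewise continuousOn_const hB
  have hosc : moebiusIntegral (q + n * s - n - 1) (n * s) (oscIntegral p f)
      = moebiusIntegral (q + n * s - n - 1) (n * s) (oscIntegral p g) :=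
    moebiusIntegral_congr _ _ fun z hz => oscIntegral_congr p (fun w hw => (hgf w hw).symm) hz
  have hfg : moebiusIntegral (q + n * s - n - 1) (n * s) (fun z => ‖f z‖ₑ ^ p)
      = moebiusIntegral (q + n * s - n - 1) (n * s) (fun z => ‖g z‖ₑ ^ p) :=
    moebiusIntegral_congr _ _ fun z hz => by rw [hgf z hz]
  have hN : f ∈ NSpace n p q s ↔ ∃ C : ℝ≥0∞, C ≠ ⊤ ∧ ∀ a ∈ unitBall n,
      moebiusIntegral (q + n * s - n - 1) (n * s) (fun z => ‖g z‖ₑ ^ p) a ≤ C := by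
    rw [← hfg, ← iSup_lintegral_weight_lt_top_iff]
    exact ⟨fun h => h.2, fun h => ⟨hf, h⟩⟩
  have hO := oscFunctional_lt_top_iff hp q s f
  rw [hosc] at hO
  have hfwd : oscFunctional p q s f < ⊤ → f ∈ NSpace n p q s := by
    rw [hN, hO]
    rintro ⟨J, hJt, hJ⟩
    exact moebiusIntegral_enorm_rpow_le hn hp ht hns (by linarith) hgm hgd hJt hJ
  refine ⟨hfwd, fun hqs => ⟨?_, hfwd⟩⟩
  rw [hN, hO]
  rintro ⟨C, hC, h⟩
  -- Here `t < 0` is the extra hypothesis, and the condition on `2c` amounts to `n s < q + n + 1`,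
  -- which follows from it.
  obtain ⟨C', hC', h'⟩ := moebiusIntegral_oscIntegral_le (n := n) hn (p := p)
    (t := q + n * s - n - 1) (c := n * s) hp hns.le (by linarith) (by linarith) (by linarith)
  exact ⟨C' * C, ENNReal.mul_ne_top hC' hC,
    fun a ha => (h' g hgm a ha).trans (mul_le_mul_right (h a ha) _)⟩
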